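/- For a real polynomial $h$ in $n$ variables let $\|h\|_2 := \sup_{x\in\mathbb{R}^n,\ \|x\|_2=1}|h(x)|$. For a homogeneous polynomial $h$ of even degree $d$, a symmetric real matrix $M$ with rows and columns indexed by $[n]^{d/2}$ is called a matrix representation of $h$ if $(x^{\otimes d/2})^{T} M\, x^{\otimes d/2} = h(x)$ for all $x\in\mathbb{R}^n$, and $\|h\|_{sp}$ denotes the infimum of the spectral norms $\|M\|_2$ over all matrix representations $M$ of $h$. For a graph $G$ on the vertex set $[n]$ let $$f_G(x_1,\dots,x_n) := \sum_{\{i_1,i_2,i_3,i_4\}} x_{i_1}x_{i_2}x_{i_3}x_{i_4},$$ where the sum is over the $4$-cliques of $G$; this is a degree-$4$ homogeneous polynomial with non-negative coefficients. **Theorem.** There are absolute constants $C$ and $K$ such that for every $n\ge 2$ the following holds. Let $G\sim G_{n,p}$ be the random graph on $[n]$ with edge probability $p=n^{-1/3}$, and let $f=f_G$. Then with probability at least $1-K/n$, for every positive integer $q$ divisible by $4$, $$\frac{\|f^{q/4}\|_{sp}}{\|f^{q/4}\|_2}\ \ge\ \frac{n^{q/24}}{(q\log n)^{Cq}} \qquad\text{and}\qquad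 \frac{\|f^{q/4}\|_{sp}^{4/q}}{\|f\|_2}\ \ge\ \frac{n^{1/6}}{(q\log n)^{C}}.$$ -/

import Mathlib

/-- The sup-norm `‖h‖₂ = sup_{‖x‖₂ = 1} |h(x)|` of a real polynomial in `n` variables over the
Euclidean unit sphere. -/
noncomputable def sphereNorm {n : ℕ} (h : MvPolynomial (Fin n) ℝ) : ℝ :=
  ⨆ x : Metric.sphere (0 : EuclideanSpace ℝ (Fin n)) 1,
    |MvPolynomial.eval (fun i => (x : EuclideanSpace ℝ (Fin n)) i) h|

/-- The tensor power `x^{⊗k}`, a vector indexed by the tuples in `[n]^k`. -/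
def tensorPower {n : ℕ} (k : ℕ) (x : Fin n → ℝ) : (Fin k → Fin n) → ℝ :=
  fun I => ∏ l, x (I l)

/-- `M` is a (symmetric) degree-`d` matrix representation of `h`, for even `d`:
`(x^{⊗d/2})ᵀ M x^{⊗d/2} = h(x)` for all `x`. -/
def IsMatrixRep {n : ℕ} (d : ℕ) (h : MvPolynomial (Fin n) ℝ)
    (M : Matrix (Fin (d / 2) → Fin n) (Fin (d / 2) → Fin n) ℝ) : Prop :=
  M.IsSymm ∧ ∀ x : Fin n → ℝ,
    tensorPower (d / 2) x ⬝ᵥ M.mulVec (tensorPower (d / 2) x) = MvPolynomial.eval x h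

/-- `‖h‖_sp` for a homogeneous polynomial `h` of even degree `d`: the infimum of the spectral
norms (the `ℓ²` operator norms) of the degree-`d` matrix representations of `h`. -/
noncomputable def spNorm {n : ℕ} (d : ℕ) (h : MvPolynomial (Fin n) ℝ) : ℝ :=
  sInf {r : ℝ | ∃ M : Matrix (Fin (d / 2) → Fin n) (Fin (d / 2) → Fin n) ℝ,
    IsMatrixRep d h M ∧ r = ‖Matrix.toEuclideanCLM (𝕜 := ℝ) M‖}

open Classical in
/-- The clique polynomial of a graph `G` on `[n]`: the sum of `x_{i₁} x_{i₂} x_{i₃} x_{i₄}` over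
the `4`-cliques `{i₁, i₂, i₃, i₄}` of `G`. -/
noncomputable def cliquePoly {n : ℕ} (G : SimpleGraph (Fin n)) : MvPolynomial (Fin n) ℝ :=
  ∑ s ∈ G.cliqueFinset 4, ∏ i ∈ s, MvPolynomial.X i

/-- The edge probability `p = n^{-1/3}`. -/
noncomputable def edgeProb (n : ℕ) : unitInterval :=
  ⟨(n : ℝ) ^ (-(1 / 3) : ℝ), by
    refine ⟨by positivity, ?_⟩
    rcases Nat.eq_zero_or_pos n with rfl | hn
    · rw [Nat.cast_zero, Real.zero_rpow (by norm_num)]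
      exact zero_le_one
    · exact Real.rpow_le_one_of_one_le_of_nonpos (by exact_mod_cast hn) (by norm_num)⟩

/-- The law of the random graph `G_{n,p}` on `[n]` with `p = n^{-1/3}`. -/
noncomputable def randomGraph (n : ℕ) : MeasureTheory.Measure (SimpleGraph (Fin n)) :=
  SimpleGraph.binomialRandom (Fin n) (edgeProb n)

/-! Write `L = log n`, `θ = n^{1/3} = 1/p`, `N` for the number of 4-cliques and `m = q/4`. The
random graph enters only through `IsTypical`: up to factors `L`, vertex sets of size at most 3 have
few common neighbours, no two vertex sets span many more edges than expected, and `N` is at least of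
order `n^2`. First moments (union bounds) give the first two properties, and a second moment gives
the third.

Sphere norm: `‖f‖₂` is polylogarithmic (`IsTypical.abs_eval_cliquePoly_le`). Split the coordinates
into dyadic levels and order each clique by decreasing size of its coordinates. The last coordinate
is at most of the order of the third, and the last vertex has only `O(L)` choices given the other
three. This leaves a weighted triangle count, bounded level by level in
`IsTypical.card_adjTriples_le`.

Spectral norm: let `M` represent `f^m`. The entries of `M` at positions whose monomial occurs in
`f^m` sum to `f^m(1,…,1) = N^m`. There are at most `N^m (4m)^{4m}` such positions, and they lie in a
set `R` of rows, each with square sum at most `‖M‖^2`. Cauchy–Schwarz gives `N^m ≤ (4m)^{4m} |R|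
‖M‖^2` (`IsMatrixRep.sq_eval_one_le`). A row in `R` is a product of `m` subcliques of total size
`2m`. Up to logarithms the cliques of sizes 0,…,4 number `1, n, n^{5/3}, n^2, n^2`, so a generating
function at `z = √n` gives `|R| ≲ n^m (n^{2/3})^m`. Hence `‖M‖^2 ≳ n^{2m - 5m/3} = n^{m/3}`, that
is, `‖M‖ ≳ n^{q/24}`. -/

open MeasureTheory

/-! ### Probability estimates in the binomial random graph -/

instance instDiscreteMeasurableSpaceSimpleGraphFin (n : ℕ) :
    DiscreteMeasurableSpace (SimpleGraph (Fin n)) := by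
  have : MeasurableSingletonClass (SimpleGraph (Fin n)) := by
    refine ⟨fun G => ?_⟩
    have h : ({G} : Set (SimpleGraph (Fin n))) = SimpleGraph.edgeSet ⁻¹' {G.edgeSet} := by
      ext H
      simp
    rw [h]
    exact SimpleGraph.measurableEmbedding_edgeSet.measurable (measurableSet_singleton _)
  infer_instance

instance instIsProbabilityMeasureRandomGraph (n : ℕ) : IsProbabilityMeasure (randomGraph n) := by
  unfold randomGraph
  infer_instance

/-- The probability that the random graph contains a given set of edges. -/
theorem randomGraph_real_subset_edgeSet {n : ℕ} (F : Finset (Sym2 (Fin n)))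
    (hF : ∀ e ∈ F, ¬ e.IsDiag) :
    (randomGraph n).real {G | (F : Set (Sym2 (Fin n))) ⊆ G.edgeSet} =
      (edgeProb n : ℝ) ^ F.card := by
  classical
  have key : randomGraph n {G | (F : Set (Sym2 (Fin n))) ⊆ G.edgeSet} =
      (unitInterval.toNNReal (edgeProb n) : ENNReal) ^ F.card := by
    rw [randomGraph, SimpleGraph.binomialRandom_eq_map,
      Measure.map_apply SimpleGraph.measurable_fromEdgeSet (Set.toFinite _).measurableSet,
      ProbabilityTheory.setBernoulli_apply']
    -- `SimpleGraph.fromEdgeSet` discards loops, so the event is a cylinder on the coordinates in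
    -- `F` because `F` has no diagonal element.
    have hpi : ((fun p : Sym2 (Fin n) → Prop => {i | p i}) ⁻¹' (SimpleGraph.fromEdgeSet ⁻¹'
        {G | (F : Set (Sym2 (Fin n))) ⊆ G.edgeSet})) =
        Set.pi (F : Set (Sym2 (Fin n))) (fun _ => {True}) := by
      ext P
      simp only [Set.mem_preimage, Set.mem_pi, SimpleGraph.edgeSet_fromEdgeSet, Set.mem_ofPred_eq]
      constructor
      · intro h e he
        simpa using (h he).1
      · intro h e he
        exact ⟨by simpa using h e he, by simpa using hF e he⟩
    rw [hpi, Measure.infinitePi_pi]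
    · rw [Finset.prod_eq_pow_card]
      intro e he
      have := hF e he
      simp [this]
    · intro e he
      exact MeasurableSet.of_discrete
  rw [measureReal_def, key]
  simp

/-- Union bound for the event that the random graph contains one of the members of a family of
edge sets of the same size. -/
theorem randomGraph_real_exists_subset_edgeSet_le {n : ℕ} {ι : Type*} (s : Finset ι)
    (F : ι → Finset (Sym2 (Fin n))) (hF : ∀ i ∈ s, ∀ e ∈ F i, ¬ e.IsDiag) (t : ℕ)
    (ht : ∀ i ∈ s, (F i).card = t) :
    (randomGraph n).real {G | ∃ i ∈ s, (F i : Set (Sym2 (Fin n))) ⊆ G.edgeSet} ≤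
      s.card * (edgeProb n : ℝ) ^ t := by
  have h : {G : SimpleGraph (Fin n) | ∃ i ∈ s, (F i : Set (Sym2 (Fin n))) ⊆ G.edgeSet} =
      ⋃ i ∈ s, {G | (F i : Set (Sym2 (Fin n))) ⊆ G.edgeSet} := by
    ext G
    simp
  rw [h]
  refine (measureReal_biUnion_finset_le _ _).trans ?_
  rw [← nsmul_eq_mul, ← Finset.sum_const]
  refine Finset.sum_le_sum fun i hi => ?_
  rw [randomGraph_real_subset_edgeSet _ (hF i hi), ht i hi]

/-- Combines `N.choose t ≤ N^t / t!`, `t^t / t! ≤ e^t` and `N r ≤ t/9 ≤ t e^{-2}`. -/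
theorem choose_mul_pow_le_exp_neg {N t : ℕ} {r : ℝ} (hr : 0 ≤ r) (ht : 9 * (N * r) ≤ t) :
    (N.choose t : ℝ) * r ^ t ≤ Real.exp (-t) := by
  have he : Real.exp 2 ≤ 9 := by
    have h1 := Real.exp_one_lt_d9
    have h2 : Real.exp 2 = Real.exp 1 * Real.exp 1 := by
      rw [← Real.exp_add]
      norm_num
    rw [h2]
    nlinarith [Real.exp_pos 1]
  have h1 : (N.choose t : ℝ) * r ^ t ≤ (N * r) ^ t / t.factorial := by
    rw [mul_pow, mul_div_right_comm]
    exact mul_le_mul_of_nonneg_right (Nat.choose_le_pow_div t N) (by positivity)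
  have h2 : (N * r : ℝ) ^ t ≤ (t * Real.exp (-2)) ^ t := by
    refine pow_le_pow_left₀ (by positivity) ?_ t
    rw [Real.exp_neg, ← div_eq_mul_inv, le_div_iff₀ (Real.exp_pos 2)]
    have : 0 ≤ (N : ℝ) * r := by positivity
    nlinarith
  calc (N.choose t : ℝ) * r ^ t ≤ (N * r) ^ t / t.factorial := h1
    _ ≤ (t * Real.exp (-2)) ^ t / t.factorial := by gcongr
    _ = (t : ℝ) ^ t / t.factorial * Real.exp (-2) ^ t := by rw [mul_pow]; ring
    _ ≤ Real.exp t * Real.exp (-2) ^ t :=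
        mul_le_mul_of_nonneg_right (Real.pow_div_factorial_le_exp _ (by positivity) _)
          (by positivity)
    _ = Real.exp (-t) := by
        rw [← Real.exp_nat_mul, ← Real.exp_add]
        congr 1
        ring

theorem edgeProb_coe (n : ℕ) : (edgeProb n : ℝ) = (n : ℝ) ^ (-(1 / 3) : ℝ) := rfl

theorem edgeProb_nonneg (n : ℕ) : 0 ≤ (edgeProb n : ℝ) := (edgeProb n).2.1

open Classical in
/-- The common neighbours of the vertices in `S`. -/
noncomputable def commonNbrs {n : ℕ} (G : SimpleGraph (Fin n)) (S : Finset (Fin n)) :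
    Finset (Fin n) :=
  Finset.univ.filter fun u => ∀ v ∈ S, G.Adj v u

theorem mem_commonNbrs {n : ℕ} {G : SimpleGraph (Fin n)} {S : Finset (Fin n)} {u : Fin n} :
    u ∈ commonNbrs G S ↔ ∀ v ∈ S, G.Adj v u := by
  simp [commonNbrs]

open Classical in
/-- The pairs in `A × B` that are adjacent. -/
noncomputable def adjPairs {n : ℕ} (G : SimpleGraph (Fin n)) (A B : Finset (Fin n)) :
    Finset (Fin n × Fin n) :=
  (A ×ˢ B).filter fun x => G.Adj x.1 x.2

theorem mem_adjPairs {n : ℕ} {G : SimpleGraph (Fin n)} {A B : Finset (Fin n)}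
    {x : Fin n × Fin n} : x ∈ adjPairs G A B ↔ x.1 ∈ A ∧ x.2 ∈ B ∧ G.Adj x.1 x.2 := by
  simp [adjPairs, and_assoc]

theorem exp_neg_le_of_mul_log_le {n : ℕ} (hn : 0 < n) {k : ℕ} {t : ℝ} (ht : k * Real.log n ≤ t) :
    Real.exp (-t) ≤ ((n : ℝ) ^ k)⁻¹ := by
  have h : ((n : ℝ) ^ k)⁻¹ = Real.exp (-(k * Real.log n)) := by
    rw [Real.exp_neg, Real.exp_nat_mul, Real.exp_log (by exact_mod_cast hn)]
  rw [h]
  exact Real.exp_le_exp.2 (by linarith)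

/-- Union bound over the complete bipartite graphs between a `k`-set and a disjoint `t`-set, each
with `k t` edges. `h1` controls the choice of the `t`-set; `h2` pays for the `n^k` choices of the
`k`-set and leaves `1/n`. -/
theorem randomGraph_real_exists_commonNbrs_le {n : ℕ} (hn : 0 < n) (k t : ℕ)
    (h1 : 9 * (n * (edgeProb n : ℝ) ^ k) ≤ t) (h2 : (k + 1) * Real.log n ≤ t) :
    (randomGraph n).real {G | ∃ S : Finset (Fin n), S.card = k ∧ t ≤ (commonNbrs G S).card} ≤
      1 / n := by
  classical
  let s : Finset (Finset (Fin n) × Finset (Fin n)) :=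
    (Finset.univ.powersetCard k ×ˢ Finset.univ.powersetCard t).filter fun x => Disjoint x.1 x.2
  let F : Finset (Fin n) × Finset (Fin n) → Finset (Sym2 (Fin n)) := fun x =>
    (x.1 ×ˢ x.2).image fun y => s(y.1, y.2)
  have hs : ∀ x ∈ s, x.1.card = k ∧ x.2.card = t ∧ Disjoint x.1 x.2 := by
    intro x hx
    simp only [s, Finset.mem_filter, Finset.mem_product, Finset.mem_powersetCard] at hx
    exact ⟨hx.1.1.2, hx.1.2.2, hx.2⟩
  have hsub : {G : SimpleGraph (Fin n) | ∃ S : Finset (Fin n), S.card = k ∧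
      t ≤ (commonNbrs G S).card} ⊆
      {G | ∃ i ∈ s, (F i : Set (Sym2 (Fin n))) ⊆ G.edgeSet} := by
    rintro G ⟨S, hS, hT⟩
    obtain ⟨T, hTs, hTc⟩ := Finset.exists_subset_card_eq hT
    refine ⟨(S, T), ?_, ?_⟩
    · simp only [s, Finset.mem_filter, Finset.mem_product, Finset.mem_powersetCard,
        Finset.subset_univ, true_and]
      refine ⟨⟨hS, hTc⟩, Finset.disjoint_left.2 fun v hv hv' => ?_⟩
      exact G.loopless.irrefl v (mem_commonNbrs.1 (hTs hv') v hv)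
    · intro e he
      simp only [F, Finset.coe_image, Set.mem_image, Finset.mem_coe, Finset.mem_product] at he
      obtain ⟨y, ⟨hy1, hy2⟩, rfl⟩ := he
      exact mem_commonNbrs.1 (hTs hy2) _ hy1
  have hdiag : ∀ i ∈ s, ∀ e ∈ F i, ¬ e.IsDiag := by
    intro x hx e he
    simp only [F, Finset.mem_image, Finset.mem_product] at he
    obtain ⟨y, ⟨hy1, hy2⟩, rfl⟩ := he
    rw [Sym2.mk_isDiag_iff]
    intro h
    exact Finset.disjoint_left.1 (hs x hx).2.2 hy1 (h ▸ hy2)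
  have hcard : ∀ i ∈ s, (F i).card = k * t := by
    intro x hx
    obtain ⟨hk, ht, hd⟩ := hs x hx
    rw [Finset.card_image_of_injOn, Finset.card_product, hk, ht]
    rintro ⟨a, b⟩ hab ⟨c, d⟩ hcd h
    simp only [Finset.coe_product, Set.mem_prod, Finset.mem_coe] at hab hcd
    rcases Sym2.eq_iff.1 h with h | h
    · exact Prod.ext h.1 h.2
    · obtain ⟨rfl, -⟩ := h
      exact absurd hcd.2 (Finset.disjoint_left.1 hd hab.1)
  have hsc : (s.card : ℝ) ≤ n ^ k * n.choose t := by
    have : s.card ≤ n ^ k * n.choose t := by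
      refine (Finset.card_filter_le _ _).trans ?_
      rw [Finset.card_product, Finset.card_powersetCard, Finset.card_powersetCard,
        Finset.card_fin]
      exact Nat.mul_le_mul_right _ (Nat.choose_le_pow n k)
    exact_mod_cast this
  have hp := edgeProb_nonneg n
  have hn' : (0 : ℝ) < n := by exact_mod_cast hn
  calc (randomGraph n).real _ ≤ (randomGraph n).real _ := measureReal_mono hsub (measure_ne_top _ _)
    _ ≤ s.card * (edgeProb n : ℝ) ^ (k * t) :=
        randomGraph_real_exists_subset_edgeSet_le s F hdiag _ hcard
    _ ≤ (n ^ k * n.choose t) * (edgeProb n : ℝ) ^ (k * t) := by gcongr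
    _ = n ^ k * (n.choose t * ((edgeProb n : ℝ) ^ k) ^ t) := by rw [pow_mul]; ring
    _ ≤ n ^ k * ((n : ℝ) ^ (k + 1))⁻¹ := by
        gcongr
        exact (choose_mul_pow_le_exp_neg (by positivity) h1).trans
          (exp_neg_le_of_mul_log_le hn (by exact_mod_cast h2))
    _ = 1 / n := by
        rw [pow_succ]
        field_simp

/-- The number of pairs is at most twice the number of edges they span. -/
theorem card_adjPairs_le_two_mul {n : ℕ} (G : SimpleGraph (Fin n))
    (A B : Finset (Fin n)) :
    (adjPairs G A B).card ≤ 2 * ((adjPairs G A B).image fun y => s(y.1, y.2)).card := by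
  refine Finset.card_le_mul_card_image (f := fun y : Fin n × Fin n => s(y.1, y.2)) _ _ ?_
  intro e _
  induction e using Sym2.ind with
  | _ a b =>
    refine (Finset.card_le_card (t := {(a, b), (b, a)}) ?_).trans Finset.card_le_two
    rintro ⟨c, d⟩ h
    simp only [Finset.mem_filter] at h
    rcases Sym2.eq_iff.1 h.2 with h | h <;> simp [h.1, h.2]

/-- Allows a union bound over all vertex sets when the failure probability for `A` carries a factor
`n^{-|A|}`. -/
theorem sum_inv_pow_card_le {n : ℕ} (hn : 0 < n) :
    ∑ A : Finset (Fin n), ((n : ℝ) ^ A.card)⁻¹ ≤ Real.exp 1 := by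
  have h : ∑ A : Finset (Fin n), ((n : ℝ) ^ A.card)⁻¹ = (1 + (n : ℝ)⁻¹) ^ n := by
    have := Finset.prod_one_add (f := fun _ : Fin n => (n : ℝ)⁻¹) Finset.univ
    simp only [Finset.prod_const, Finset.card_fin, Finset.powerset_univ] at this
    rw [this]
    exact Finset.sum_congr rfl fun A _ => (inv_pow _ _).symm
  rw [h]
  calc (1 + (n : ℝ)⁻¹) ^ n ≤ Real.exp ((n : ℝ)⁻¹) ^ n := by
        gcongr
        rw [add_comm]
        exact Real.add_one_le_exp _
    _ = Real.exp 1 := by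
        rw [← Real.exp_nat_mul, mul_inv_cancel₀]
        exact_mod_cast hn.ne'

/-- For fixed `A`, `B` the failure probability is at most `n^{-|A|-|B|-1}`, which is summable over
all pairs. The outer factor 2 is there because an edge inside `A ∩ B` gives two ordered pairs; the
final `+ 1` pays for rounding up. -/
theorem randomGraph_real_exists_adjPairs_le {n : ℕ} (hn : 0 < n) :
    (randomGraph n).real {G | ∃ A B : Finset (Fin n),
      2 * (9 * (A.card * B.card * (edgeProb n : ℝ)) + (A.card + B.card + 1) * Real.log n + 1) ≤
        (adjPairs G A B).card} ≤ Real.exp 1 ^ 2 / n := by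
  classical
  let t : Finset (Fin n) → Finset (Fin n) → ℕ := fun A B =>
    ⌈9 * (A.card * B.card * (edgeProb n : ℝ)) + (A.card + B.card + 1) * Real.log n⌉₊
  let s : Finset (Fin n) → Finset (Fin n) → Finset (Finset (Sym2 (Fin n))) := fun A B =>
    (((A ×ˢ B).filter fun y => y.1 ≠ y.2).image fun y => s(y.1, y.2)).powersetCard (t A B)
  have hp := edgeProb_nonneg n
  have hn' : (0 : ℝ) < n := by exact_mod_cast hn
  have hL : 0 ≤ Real.log n := Real.log_natCast_nonneg n
  have hsub : {G : SimpleGraph (Fin n) | ∃ A B : Finset (Fin n),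
      2 * (9 * (A.card * B.card * (edgeProb n : ℝ)) + (A.card + B.card + 1) * Real.log n + 1) ≤
        (adjPairs G A B).card} ⊆
      ⋃ x ∈ (Finset.univ : Finset (Finset (Fin n) × Finset (Fin n))),
        {G | ∃ F ∈ s x.1 x.2, (F : Set (Sym2 (Fin n))) ⊆ G.edgeSet} := by
    rintro G ⟨A, B, hAB⟩
    simp only [Finset.mem_univ, Set.iUnion_true, Set.mem_iUnion]
    refine ⟨(A, B), ?_⟩
    have hcard : t A B ≤ ((adjPairs G A B).image fun y => s(y.1, y.2)).card := by
      have h1 : ((adjPairs G A B).card : ℝ) ≤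
          2 * ((adjPairs G A B).image fun y => s(y.1, y.2)).card := by
        exact_mod_cast card_adjPairs_le_two_mul G A B
      have h2 : (t A B : ℝ) < _ + 1 := Nat.ceil_lt_add_one (by positivity)
      have : (t A B : ℝ) ≤ ((adjPairs G A B).image fun y => s(y.1, y.2)).card := by linarith
      exact_mod_cast this
    obtain ⟨F, hFs, hFc⟩ := Finset.exists_subset_card_eq hcard
    refine ⟨F, ?_, ?_⟩
    · refine Finset.mem_powersetCard.2 ⟨hFs.trans (Finset.image_subset_image ?_), hFc⟩
      intro y hy
      obtain ⟨h1, h2, h3⟩ := mem_adjPairs.1 hy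
      simp [h1, h2, h3.ne]
    · intro e he
      obtain ⟨y, hy, rfl⟩ := Finset.mem_image.1 (hFs he)
      exact (mem_adjPairs.1 hy).2.2
  have hterm : ∀ A B : Finset (Fin n),
      (randomGraph n).real {G | ∃ F ∈ s A B, (F : Set (Sym2 (Fin n))) ⊆ G.edgeSet} ≤
        (n : ℝ)⁻¹ * (((n : ℝ) ^ A.card)⁻¹ * ((n : ℝ) ^ B.card)⁻¹) := by
    intro A B
    have h1 := randomGraph_real_exists_subset_edgeSet_le (n := n) (s A B) id (by
      intro F hF e he
      obtain ⟨y, hy, rfl⟩ := Finset.mem_image.1 ((Finset.mem_powersetCard.1 hF).1 he)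
      rw [Sym2.mk_isDiag_iff]
      exact (Finset.mem_filter.1 hy).2) (t A B) (fun F hF => (Finset.mem_powersetCard.1 hF).2)
    refine h1.trans ?_
    have h2 : ((s A B).card : ℝ) ≤ (A.card * B.card).choose (t A B) := by
      rw [Finset.card_powersetCard]
      refine Nat.cast_le.2 (Nat.choose_le_choose _ ?_)
      refine Finset.card_image_le.trans ((Finset.card_filter_le _ _).trans ?_)
      rw [Finset.card_product]
    have h3 : 9 * (A.card * B.card * (edgeProb n : ℝ)) + (A.card + B.card + 1) * Real.log n ≤
        t A B := Nat.le_ceil _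
    have h4 : 0 ≤ (A.card + B.card + 1) * Real.log n := by positivity
    have h5 : 0 ≤ 9 * (A.card * B.card * (edgeProb n : ℝ)) := by positivity
    calc ((s A B).card : ℝ) * (edgeProb n : ℝ) ^ t A B
        ≤ (A.card * B.card).choose (t A B) * (edgeProb n : ℝ) ^ t A B := by gcongr
      _ ≤ Real.exp (-(t A B : ℝ)) := choose_mul_pow_le_exp_neg hp (by push_cast; linarith)
      _ ≤ ((n : ℝ) ^ (A.card + B.card + 1))⁻¹ :=
          exp_neg_le_of_mul_log_le hn (by push_cast; linarith)
      _ = _ := by rw [pow_succ, pow_add, mul_inv, mul_inv]; ring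
  calc (randomGraph n).real _ ≤ (randomGraph n).real _ := measureReal_mono hsub (measure_ne_top _ _)
    _ ≤ ∑ x : Finset (Fin n) × Finset (Fin n),
        (randomGraph n).real {G | ∃ F ∈ s x.1 x.2, (F : Set (Sym2 (Fin n))) ⊆ G.edgeSet} :=
        measureReal_biUnion_finset_le _ _
    _ ≤ ∑ x : Finset (Fin n) × Finset (Fin n),
        (n : ℝ)⁻¹ * (((n : ℝ) ^ x.1.card)⁻¹ * ((n : ℝ) ^ x.2.card)⁻¹) :=
        Finset.sum_le_sum fun x _ => hterm x.1 x.2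
    _ = (n : ℝ)⁻¹ * ((∑ A : Finset (Fin n), ((n : ℝ) ^ A.card)⁻¹) *
        ∑ B : Finset (Fin n), ((n : ℝ) ^ B.card)⁻¹) := by
        rw [← Finset.mul_sum, Finset.sum_mul_sum, ← Finset.sum_product', Finset.univ_product_univ]
    _ ≤ (n : ℝ)⁻¹ * (Real.exp 1 * Real.exp 1) := by
        have h0 : 0 ≤ ∑ A : Finset (Fin n), ((n : ℝ) ^ A.card)⁻¹ := by positivity
        gcongr <;> exact sum_inv_pow_card_le hn
    _ = Real.exp 1 ^ 2 / n := by ring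

/-! ### The number of 4-cliques, by the second moment method. -/

/-- Chebyshev's inequality for the number of events that occur. -/
theorem measureReal_count_le_half_mul_le {Ω ι : Type*} [MeasurableSpace Ω]
    [DiscreteMeasurableSpace Ω] [Finite Ω] (μ : Measure Ω) [IsProbabilityMeasure μ]
    (s : Finset ι) (E : ι → Set Ω) (r : ℝ) (hr : ∀ i ∈ s, μ.real (E i) = r) :
    (s.card * r / 2) ^ 2 *
      μ.real {ω | ∑ i ∈ s, (E i).indicator (1 : Ω → ℝ) ω ≤ s.card * r / 2} ≤
      ∑ i ∈ s, ∑ j ∈ s, (μ.real (E i ∩ E j) - r ^ 2) := by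
  let X : ι → Ω → ℝ := fun i => (E i).indicator 1
  have hint : ∀ f : Ω → ℝ, Integrable f μ := fun f => Integrable.of_finite
  have hind : ∀ S : Set Ω, ∫ ω, S.indicator (1 : Ω → ℝ) ω ∂μ = μ.real S := fun S =>
    integral_indicator_one MeasurableSet.of_discrete
  have hsq : ∫ ω, (∑ i ∈ s, X i ω - s.card * r) ^ 2 ∂μ =
      ∑ i ∈ s, ∑ j ∈ s, (μ.real (E i ∩ E j) - r ^ 2) := by
    have h1 : ∀ ω, (∑ i ∈ s, X i ω - s.card * r) ^ 2 =
        ∑ i ∈ s, ∑ j ∈ s, (X i ω - r) * (X j ω - r) := by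
      intro ω
      rw [← Finset.sum_mul_sum, ← sq, Finset.sum_sub_distrib, Finset.sum_const, nsmul_eq_mul]
    simp_rw [h1]
    rw [integral_finsetSum _ fun i _ => hint _]
    refine Finset.sum_congr rfl fun i hi => ?_
    rw [integral_finsetSum _ fun i _ => hint _]
    refine Finset.sum_congr rfl fun j hj => ?_
    have h2 : ∀ ω, (X i ω - r) * (X j ω - r) =
        (E i ∩ E j).indicator (1 : Ω → ℝ) ω - r * X i ω - r * X j ω + r ^ 2 := by
      intro ω
      have : (E i ∩ E j).indicator (1 : Ω → ℝ) ω = X i ω * X j ω := by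
        rw [Set.inter_indicator_one]
        rfl
      rw [this]
      ring
    simp_rw [h2]
    rw [integral_add (hint _) (hint _), integral_sub (hint _) (hint _),
      integral_sub (hint _) (hint _), integral_const_mul, integral_const_mul, hind]
    simp only [X]
    rw [hind, hind, hr i hi, hr j hj]
    simp
    ring
  rw [← hsq]
  have hmarkov := mul_meas_ge_le_integral_of_nonneg (μ := μ)
    (f := fun ω => (∑ i ∈ s, X i ω - s.card * r) ^ 2)
    (Filter.Eventually.of_forall fun ω => sq_nonneg _) (hint _) ((s.card * r / 2) ^ 2)
  refine le_trans ?_ hmarkov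
  refine mul_le_mul_of_nonneg_left (measureReal_mono ?_ (measure_ne_top _ _)) (by positivity)
  intro ω hω
  have hω' : ∑ i ∈ s, X i ω ≤ s.card * r / 2 := hω
  simp only [Set.mem_ofPred_eq]
  have h0 : 0 ≤ s.card * r := by
    rcases s.eq_empty_or_nonempty with rfl | ⟨i, hi⟩
    · simp
    · rw [← hr i hi]
      positivity
  rw [← neg_sq (∑ i ∈ s, X i ω - s.card * r)]
  exact pow_le_pow_left₀ (by positivity) (by linarith) 2

/-- The pairs of distinct elements of `S`. -/
def pairsOf {n : ℕ} (S : Finset (Fin n)) : Finset (Sym2 (Fin n)) :=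
  S.offDiag.image fun x => s(x.1, x.2)

theorem mk_mem_pairsOf {n : ℕ} {S : Finset (Fin n)} {a b : Fin n} :
    s(a, b) ∈ pairsOf S ↔ a ∈ S ∧ b ∈ S ∧ a ≠ b := by
  simp only [pairsOf, Finset.mem_image, Finset.mem_offDiag, Prod.exists]
  constructor
  · rintro ⟨c, d, ⟨hc, hd, hcd⟩, h⟩
    rcases Sym2.eq_iff.1 h with ⟨rfl, rfl⟩ | ⟨rfl, rfl⟩
    · exact ⟨hc, hd, hcd⟩
    · exact ⟨hd, hc, hcd.symm⟩
  · rintro ⟨h1, h2, h3⟩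
    exact ⟨a, b, ⟨h1, h2, h3⟩, rfl⟩

theorem not_isDiag_of_mem_pairsOf {n : ℕ} {S : Finset (Fin n)} {e : Sym2 (Fin n)}
    (he : e ∈ pairsOf S) : ¬ e.IsDiag := by
  induction e using Sym2.ind with
  | _ a b => exact (mk_mem_pairsOf.1 he).2.2

theorem card_pairsOf {n : ℕ} (S : Finset (Fin n)) : (pairsOf S).card = S.card.choose 2 :=
  Sym2.card_image_offDiag S

theorem pairsOf_inter {n : ℕ} (S T : Finset (Fin n)) :
    pairsOf S ∩ pairsOf T = pairsOf (S ∩ T) := by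
  ext e
  induction e using Sym2.ind with
  | _ a b =>
    simp only [Finset.mem_inter, mk_mem_pairsOf]
    tauto

theorem pairsOf_subset_edgeSet_iff {n : ℕ} {G : SimpleGraph (Fin n)} {S : Finset (Fin n)} :
    (pairsOf S : Set (Sym2 (Fin n))) ⊆ G.edgeSet ↔ G.IsClique S := by
  constructor
  · intro h a ha b hb hab
    exact h (mk_mem_pairsOf.2 ⟨ha, hb, hab⟩)
  · intro h e he
    induction e using Sym2.ind with
    | _ a b =>
      obtain ⟨ha, hb, hab⟩ := mk_mem_pairsOf.1 he
      exact h ha hb hab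

theorem edgeProb_pow_three {n : ℕ} : (edgeProb n : ℝ) ^ 3 = (n : ℝ)⁻¹ := by
  rw [edgeProb_coe, ← Real.rpow_natCast, ← Real.rpow_mul (Nat.cast_nonneg n)]
  norm_num
  exact Real.rpow_neg_one _

theorem edgeProb_le_one (n : ℕ) : (edgeProb n : ℝ) ≤ 1 := (edgeProb n).2.2

/-- Group by the intersection `U ⊆ S`: at most `n^{k-|U|}` sets `T` contain `U`, so each of the
`2^k` choices of `U` contributes at most `n^k`. -/
theorem sum_pow_card_inter_le {n : ℕ} (k : ℕ) (S : Finset (Fin n)) (hS : S.card = k) :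
    ∑ T ∈ (Finset.univ : Finset (Fin n)).powersetCard k, n ^ (S ∩ T).card ≤ 2 ^ k * n ^ k := by
  classical
  calc ∑ T ∈ (Finset.univ : Finset (Fin n)).powersetCard k, n ^ (S ∩ T).card
      ≤ ∑ T ∈ (Finset.univ : Finset (Fin n)).powersetCard k,
          ∑ U ∈ S.powerset, if U ⊆ T then n ^ U.card else 0 := by
        refine Finset.sum_le_sum fun T _ => ?_
        have h := Finset.single_le_sum (f := fun U => if U ⊆ T then n ^ U.card else 0)
          (fun U _ => Nat.zero_le _) (Finset.mem_powerset.2 (Finset.inter_subset_left (s₁ := S)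
            (s₂ := T)))
        simpa [Finset.inter_subset_right] using h
    _ = ∑ U ∈ S.powerset, ∑ T ∈ (Finset.univ : Finset (Fin n)).powersetCard k,
          if U ⊆ T then n ^ U.card else 0 := Finset.sum_comm
    _ ≤ ∑ U ∈ S.powerset, n ^ k := by
        refine Finset.sum_le_sum fun U hU => ?_
        have hUk : U.card ≤ k := hS ▸ Finset.card_le_card (Finset.mem_powerset.1 hU)
        rw [← Finset.sum_filter, Finset.sum_const, smul_eq_mul]
        have hcard : ((Finset.univ.powersetCard k).filter fun T : Finset (Fin n) => U ⊆ T).card ≤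
            n ^ (k - U.card) := by
          refine (Finset.card_le_card_of_injOn (fun T => T \ U)
            (t := Finset.univ.powersetCard (k - U.card)) ?_ ?_).trans ?_
          · intro T hT
            simp only [Finset.coe_filter, Finset.mem_powersetCard, Set.mem_ofPred_eq] at hT
            simp only [Finset.subset_univ, true_and, Finset.mem_coe, Finset.mem_powersetCard]
            rw [Finset.card_sdiff_of_subset hT.2, hT.1.2]
          · intro T hT T' hT' h
            simp only [Finset.coe_filter, Finset.mem_powersetCard, Set.mem_ofPred_eq] at hT hT'
            rw [← Finset.sdiff_union_of_subset hT.2, ← Finset.sdiff_union_of_subset hT'.2]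
            exact congrArg (· ∪ U) h
          · rw [Finset.card_powersetCard, Finset.card_fin]
            exact Nat.choose_le_pow _ _
        calc _ ≤ n ^ (k - U.card) * n ^ U.card := Nat.mul_le_mul_right _ hcard
          _ = n ^ k := by rw [← pow_add, Nat.sub_add_cancel hUk]
    _ = 2 ^ k * n ^ k := by
        rw [Finset.sum_const, Finset.card_powerset, hS, smul_eq_mul]

theorem randomGraph_real_inter_isClique {n : ℕ} (S T : Finset (Fin n)) :
    (randomGraph n).real ({G | G.IsClique S} ∩ {G | G.IsClique T}) =
      (edgeProb n : ℝ) ^ (pairsOf S ∪ pairsOf T).card := by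
  have h : ({G : SimpleGraph (Fin n) | G.IsClique S} ∩ {G | G.IsClique T}) =
      {G | ((pairsOf S ∪ pairsOf T : Finset _) : Set (Sym2 (Fin n))) ⊆ G.edgeSet} := by
    ext G
    simp [← pairsOf_subset_edgeSet_iff]
  rw [h, randomGraph_real_subset_edgeSet]
  intro e he
  rcases Finset.mem_union.1 he with he | he <;> exact not_isDiag_of_mem_pairsOf he

theorem randomGraph_real_isClique_four {n : ℕ} (S : Finset (Fin n)) (hS : S.card = 4) :
    (randomGraph n).real {G | G.IsClique S} = ((n : ℝ) ^ 2)⁻¹ := by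
  have h := randomGraph_real_inter_isClique S S
  rw [Set.inter_self, Finset.union_self, card_pairsOf, hS] at h
  rw [h, show Nat.choose 4 2 = 3 * 2 by rfl, pow_mul, edgeProb_pow_three, inv_pow]

/-- If the intersection has `j` vertices, the cliques share `j.choose 2` edges and the joint
probability is `p^{12 - j.choose 2}`. For `j ≤ 1` the events are uncorrelated. The uniform form
`n^{j-5}` suits `sum_pow_card_inter_le`. -/
theorem covariance_isClique_four_le {n : ℕ} (hn : 0 < n) (S T : Finset (Fin n)) (hS : S.card = 4)
    (hT : T.card = 4) :
    (randomGraph n).real ({G | G.IsClique S} ∩ {G | G.IsClique T}) - (((n : ℝ) ^ 2)⁻¹) ^ 2 ≤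
      ((n : ℝ) ^ 5)⁻¹ * n ^ (S ∩ T).card := by
  rw [randomGraph_real_inter_isClique]
  have hcard : (pairsOf S ∪ pairsOf T).card + (S ∩ T).card.choose 2 = 12 := by
    rw [← card_pairsOf, ← pairsOf_inter, Finset.card_union_add_card_inter, card_pairsOf,
      card_pairsOf, hS, hT]
    rfl
  have hle : (S ∩ T).card ≤ 4 := hS ▸ Finset.card_le_card Finset.inter_subset_left
  have hp0 := edgeProb_nonneg n
  have hp1 := edgeProb_le_one n
  have hn' : (1 : ℝ) ≤ n := by exact_mod_cast hn
  have h3 : ∀ k, (edgeProb n : ℝ) ^ (3 * k) = ((n : ℝ) ^ k)⁻¹ := fun k => by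
    rw [pow_mul, edgeProb_pow_three, inv_pow]
  have h12 : (((n : ℝ) ^ 2)⁻¹) ^ 2 = (edgeProb n : ℝ) ^ 12 := by
    rw [show 12 = 3 * 4 by rfl, h3, ← inv_pow, ← inv_pow]
    ring
  have hpos : 0 < (n : ℝ) := by linarith
  have hnn : 0 ≤ (edgeProb n : ℝ) ^ 12 := by positivity
  rw [h12]
  generalize (S ∩ T).card = j at *
  have hinv : ∀ i k, i ≤ k → ((n : ℝ) ^ k)⁻¹ ≤ ((n : ℝ) ^ i)⁻¹ := fun i k h => by
    gcongr
  interval_cases j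
  · have : (pairsOf S ∪ pairsOf T).card = 12 := hcard
    rw [this, sub_self]
    positivity
  · have : (pairsOf S ∪ pairsOf T).card = 12 := hcard
    rw [this, sub_self]
    positivity
  · have : (pairsOf S ∪ pairsOf T).card = 11 := by simpa using hcard
    rw [this]
    have h1 : (edgeProb n : ℝ) ^ 11 ≤ (edgeProb n : ℝ) ^ (3 * 3) :=
      pow_le_pow_of_le_one hp0 hp1 (by norm_num)
    rw [h3] at h1
    have h2 : ((n : ℝ) ^ 5)⁻¹ * n ^ 2 = ((n : ℝ) ^ 3)⁻¹ := by field_simp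
    linarith
  · have : (pairsOf S ∪ pairsOf T).card = 3 * 3 := by
      have : Nat.choose 3 2 = 3 := rfl
      omega
    rw [this, h3]
    have h2 : ((n : ℝ) ^ 5)⁻¹ * n ^ 3 = ((n : ℝ) ^ 2)⁻¹ := by field_simp
    linarith [hinv 2 3 (by norm_num)]
  · have : (pairsOf S ∪ pairsOf T).card = 3 * 2 := by
      have : Nat.choose 4 2 = 6 := rfl
      omega
    rw [this, h3]
    have h2 : ((n : ℝ) ^ 5)⁻¹ * n ^ 4 = ((n : ℝ) ^ 1)⁻¹ := by field_simp
    linarith [hinv 1 2 (by norm_num)]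

theorem pow_four_le_choose_four {n : ℕ} (hn : 6 ≤ n) : (n : ℝ) ^ 4 / 384 ≤ n.choose 4 := by
  have h := Nat.pow_le_choose (α := ℝ) 4 n
  refine le_trans ?_ h
  have h1 : ((n + 1 - 4 : ℕ) : ℝ) = n - 3 := by
    rw [show n + 1 - 4 = n - 3 by omega, Nat.cast_sub (by omega)]
    norm_num
  have hn' : (6 : ℝ) ≤ n := by exact_mod_cast hn
  have h2 : ((n : ℝ) / 2) ^ 4 ≤ (n - 3) ^ 4 := pow_le_pow_left₀ (by positivity) (by linarith) 4
  rw [h1, show (Nat.factorial 4 : ℝ) = 24 by norm_num [Nat.factorial]]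
  linarith

-- The mean is at least `n^2/384` and the variance at most `16 n^3`; Chebyshev at half the mean
-- gives the constant `16 · 768^2 = 9437184`.
open Classical in
theorem randomGraph_real_card_cliqueFinset_le {n : ℕ} (hn : 6 ≤ n) :
    (randomGraph n).real {G | ((G.cliqueFinset 4).card : ℝ) ≤ (n : ℝ) ^ 2 / 768} ≤
      9437184 / n := by
  have hn' : (6 : ℝ) ≤ n := by exact_mod_cast hn
  have hpos : 0 < (n : ℝ) := by linarith
  let s := (Finset.univ : Finset (Fin n)).powersetCard 4
  have hs : ∀ S ∈ s, S.card = 4 := fun S hS => (Finset.mem_powersetCard.1 hS).2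
  have hcard : (s.card : ℝ) = n.choose 4 := by
    simp [s, Finset.card_powersetCard]
  have hcheb := measureReal_count_le_half_mul_le (randomGraph n) s
    (fun S => {G | G.IsClique S}) _ fun S hS => randomGraph_real_isClique_four S (hs S hS)
  have hN : ∀ G : SimpleGraph (Fin n),
      ∑ S ∈ s, {G : SimpleGraph (Fin n) | G.IsClique S}.indicator
        (1 : SimpleGraph (Fin n) → ℝ) G = (G.cliqueFinset 4).card := by
    intro G
    have h : G.cliqueFinset 4 = s.filter fun S : Finset (Fin n) => G.IsClique S := by
      ext S
      simp [s, SimpleGraph.mem_cliqueFinset_iff, SimpleGraph.isNClique_iff, and_comm]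
    rw [h]
    simp [Set.indicator_apply]
  simp only [hN] at hcheb
  have hvar : ∑ S ∈ s, ∑ T ∈ s, ((randomGraph n).real ({G | G.IsClique S} ∩ {G | G.IsClique T}) -
      (((n : ℝ) ^ 2)⁻¹) ^ 2) ≤ 16 * (n : ℝ) ^ 3 := by
    calc _ ≤ ∑ S ∈ s, ∑ T ∈ s, ((n : ℝ) ^ 5)⁻¹ * n ^ (S ∩ T).card :=
          Finset.sum_le_sum fun S hS => Finset.sum_le_sum fun T hT =>
            covariance_isClique_four_le (by omega) S T (hs S hS) (hs T hT)
      _ ≤ ∑ S ∈ s, ((n : ℝ) ^ 5)⁻¹ * (2 ^ 4 * (n : ℝ) ^ 4) := by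
          refine Finset.sum_le_sum fun S hS => ?_
          rw [← Finset.mul_sum]
          refine mul_le_mul_of_nonneg_left ?_ (by positivity)
          exact_mod_cast sum_pow_card_inter_le 4 S (hs S hS)
      _ = s.card * (16 * (n : ℝ)⁻¹) := by
          rw [Finset.sum_const, nsmul_eq_mul]
          field_simp
          norm_num
      _ ≤ (n : ℝ) ^ 4 * (16 * (n : ℝ)⁻¹) := by
          rw [hcard]
          gcongr
          exact_mod_cast Nat.choose_le_pow n 4
      _ = 16 * (n : ℝ) ^ 3 := by field_simp
  have hmean : (n : ℝ) ^ 2 / 768 ≤ s.card * ((n : ℝ) ^ 2)⁻¹ / 2 := by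
    rw [hcard]
    have := pow_four_le_choose_four hn
    calc (n : ℝ) ^ 2 / 768 = (n : ℝ) ^ 4 / 384 * ((n : ℝ) ^ 2)⁻¹ / 2 := by
          field_simp
          norm_num
      _ ≤ _ := by gcongr
  have hmono : (randomGraph n).real {G | ((G.cliqueFinset 4).card : ℝ) ≤ (n : ℝ) ^ 2 / 768} ≤
      (randomGraph n).real
        {G | ((G.cliqueFinset 4).card : ℝ) ≤ s.card * ((n : ℝ) ^ 2)⁻¹ / 2} :=
    measureReal_mono (fun G hG => le_trans hG hmean) (measure_ne_top _ _)
  have hfin : ((n : ℝ) ^ 2 / 768) ^ 2 *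
      (randomGraph n).real {G | ((G.cliqueFinset 4).card : ℝ) ≤ (n : ℝ) ^ 2 / 768} ≤
      16 * (n : ℝ) ^ 3 := by
    refine le_trans ?_ (hcheb.trans hvar)
    gcongr
  rw [le_div_iff₀ hpos]
  have h3 : 0 < (n : ℝ) ^ 3 := by positivity
  refine le_of_mul_le_mul_right ?_ h3
  linarith

/-! ### Pseudorandom graphs -/

/-- The inverse `n^{1/3}` of the edge probability. -/
noncomputable def cubeRoot (n : ℕ) : ℝ := (n : ℝ) ^ (1 / 3 : ℝ)

theorem cubeRoot_pow_three (n : ℕ) : cubeRoot n ^ 3 = n := by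
  rw [cubeRoot, ← Real.rpow_natCast, ← Real.rpow_mul (Nat.cast_nonneg n)]
  norm_num

theorem one_le_cubeRoot {n : ℕ} (hn : 0 < n) : 1 ≤ cubeRoot n :=
  Real.one_le_rpow (by exact_mod_cast hn) (by norm_num)

theorem edgeProb_eq_inv_cubeRoot (n : ℕ) : (edgeProb n : ℝ) = (cubeRoot n)⁻¹ := by
  rw [edgeProb_coe, cubeRoot, Real.rpow_neg (Nat.cast_nonneg n)]

open Classical in
/-- The properties of a typical `G_{n,p}` with `p = n^{-1/3}` that are used below: up to a factor
`log n`, common neighbourhoods and edge counts between sets are not much larger than expected,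
and the number of `4`-cliques is not much smaller than expected. -/
structure IsTypical {n : ℕ} (G : SimpleGraph (Fin n)) : Prop where
  card_commonNbrs_le : ∀ S : Finset (Fin n), S.card ≤ 3 →
    ((commonNbrs G S).card : ℝ) ≤ 13 * Real.log n * cubeRoot n ^ (3 - S.card)
  card_adjPairs_le : ∀ A B : Finset (Fin n),
    ((adjPairs G A B).card : ℝ) ≤
      18 * Real.log n * (A.card * B.card / cubeRoot n + A.card + B.card)
  le_card_cliqueFinset : (n : ℝ) ^ 2 / 768 ≤ (G.cliqueFinset 4).card

theorem one_le_log {n : ℕ} (hn : 3 ≤ n) : 1 ≤ Real.log n := by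
  rw [Real.le_log_iff_exp_le (by positivity)]
  have h1 := Real.exp_one_lt_d9
  have h2 : (3 : ℝ) ≤ n := by exact_mod_cast hn
  linarith

open Classical in
theorem randomGraph_real_isTypical {n : ℕ} (hn : 6 ≤ n) :
    1 - 9437200 / (n : ℝ) ≤ (randomGraph n).real {G | IsTypical G} := by
  have hn0 : 0 < n := by omega
  have hnR : 0 < (n : ℝ) := by exact_mod_cast hn0
  have hL := one_le_log (n := n) (by omega)
  have hθ1 := one_le_cubeRoot hn0
  have hθ : 0 < cubeRoot n := by linarith
  let t : ℕ → ℕ := fun k => ⌈9 * (n * (edgeProb n : ℝ) ^ k) + (k + 1) * Real.log n⌉₊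
  let U : ℕ → Set (SimpleGraph (Fin n)) := fun k =>
    {G | ∃ S : Finset (Fin n), S.card = k ∧ t k ≤ (commonNbrs G S).card}
  let V : Set (SimpleGraph (Fin n)) := {G | ∃ A B : Finset (Fin n),
      2 * (9 * (A.card * B.card * (edgeProb n : ℝ)) + (A.card + B.card + 1) * Real.log n + 1) ≤
        (adjPairs G A B).card}
  let W : Set (SimpleGraph (Fin n)) :=
    {G | ((G.cliqueFinset 4).card : ℝ) ≤ (n : ℝ) ^ 2 / 768}
  have hU : ∀ k, (randomGraph n).real (U k) ≤ 1 / n := by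
    intro k
    have h0 : 0 ≤ 9 * (n * (edgeProb n : ℝ) ^ k) := by
      have := edgeProb_nonneg n
      positivity
    have h1 : 9 * (n * (edgeProb n : ℝ) ^ k) + (k + 1) * Real.log n ≤ t k := Nat.le_ceil _
    have h2 : 0 ≤ (k + 1) * Real.log n := by positivity
    exact randomGraph_real_exists_commonNbrs_le hn0 k (t k) (by linarith) (by linarith)
  have hV : (randomGraph n).real V ≤ Real.exp 1 ^ 2 / n := randomGraph_real_exists_adjPairs_le hn0
  have hW : (randomGraph n).real W ≤ 9437184 / n := randomGraph_real_card_cliqueFinset_le hn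
  have hsub : {G : SimpleGraph (Fin n) | IsTypical G}ᶜ ⊆ (⋃ k ∈ Finset.range 4, U k) ∪ (V ∪ W) := by
    intro G hG
    by_contra hbad
    simp only [Set.mem_union, not_or, Set.mem_iUnion, not_exists] at hbad
    obtain ⟨hGU, hGV, hGW⟩ := hbad
    refine hG ⟨fun S hS => ?_, fun A B => ?_, le_of_lt (not_le.1 hGW)⟩
    · have h1 : (commonNbrs G S).card < t S.card := by
        by_contra h
        exact hGU S.card (Finset.mem_range.2 (by omega)) ⟨S, rfl, not_lt.1 h⟩
      have h2 := Nat.lt_ceil.1 h1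
      have h3 : (n : ℝ) * (edgeProb n : ℝ) ^ S.card = cubeRoot n ^ (3 - S.card) := by
        rw [← cubeRoot_pow_three, edgeProb_eq_inv_cubeRoot, inv_pow, pow_sub₀ _ hθ.ne' hS]
      rw [h3] at h2
      -- The constant 13 is `9 + (k + 1)` with `k ≤ 3`.
      have h4 : 1 ≤ cubeRoot n ^ (3 - S.card) := one_le_pow₀ hθ1
      have h5 : (S.card : ℝ) ≤ 3 := by exact_mod_cast hS
      nlinarith
    -- The additive terms without `|A|` or `|B|` are absorbed by `|A| + |B|` once both sets are
    -- nonempty.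
    · by_cases hAB : A = ∅ ∨ B = ∅
      · have h0 : adjPairs G A B = ∅ := by
          rcases hAB with rfl | rfl <;> simp [adjPairs]
        rw [h0, Finset.card_empty, Nat.cast_zero]
        positivity
      · rw [not_or, ← Ne, ← Ne, ← Finset.nonempty_iff_ne_empty, ← Finset.nonempty_iff_ne_empty,
          ← Finset.card_pos, ← Finset.card_pos] at hAB
        have ha : (1 : ℝ) ≤ A.card := by exact_mod_cast hAB.1
        have hb : (1 : ℝ) ≤ B.card := by exact_mod_cast hAB.2
        have h1 : ((adjPairs G A B).card : ℝ) < _ := not_le.1 fun h => hGV ⟨A, B, h⟩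
        rw [edgeProb_eq_inv_cubeRoot, ← div_eq_mul_inv] at h1
        have h2 : 0 ≤ A.card * B.card / cubeRoot n := by positivity
        nlinarith [mul_le_mul_of_nonneg_right hL h2, mul_le_mul_of_nonneg_right ha
          (by linarith : 0 ≤ Real.log n), mul_le_mul_of_nonneg_right hb
          (by linarith : 0 ≤ Real.log n)]
  have hcompl : (randomGraph n).real {G : SimpleGraph (Fin n) | IsTypical G}ᶜ ≤ 9437200 / n := by
    calc _ ≤ (randomGraph n).real ((⋃ k ∈ Finset.range 4, U k) ∪ (V ∪ W)) :=
          measureReal_mono hsub (measure_ne_top _ _)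
      _ ≤ (randomGraph n).real (⋃ k ∈ Finset.range 4, U k) + (randomGraph n).real (V ∪ W) :=
          measureReal_union_le _ _
      _ ≤ ∑ k ∈ Finset.range 4, (randomGraph n).real (U k) +
          ((randomGraph n).real V + (randomGraph n).real W) :=
          add_le_add (measureReal_biUnion_finset_le _ _) (measureReal_union_le _ _)
      _ ≤ ∑ k ∈ Finset.range 4, (1 / n : ℝ) + (9 / n + 9437184 / n) := by
          gcongr with k hk
          · exact hU k
          · refine hV.trans ?_
            have h1 := Real.exp_one_lt_d9
            gcongr
            nlinarith [Real.exp_pos 1]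
      _ = 9437197 / n := by
          rw [Finset.sum_const, Finset.card_range, nsmul_eq_mul]
          push_cast
          ring
      _ ≤ 9437200 / n := by
          gcongr
          norm_num
  rw [probReal_compl_eq_one_sub MeasurableSet.of_discrete] at hcompl
  linarith

/-! ### The clique polynomial of a typical graph on the sphere -/

section triangles

variable {n : ℕ} {G : SimpleGraph (Fin n)}

open Classical in
/-- The triples in `A × B × C` that are pairwise adjacent. -/
noncomputable def adjTriples (G : SimpleGraph (Fin n)) (A B C : Finset (Fin n)) :
    Finset (Fin n × Fin n × Fin n) :=
  (A ×ˢ B ×ˢ C).filter fun x => G.Adj x.1 x.2.1 ∧ G.Adj x.1 x.2.2 ∧ G.Adj x.2.1 x.2.2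

theorem mem_adjTriples {A B C : Finset (Fin n)} {x : Fin n × Fin n × Fin n} :
    x ∈ adjTriples G A B C ↔ (x.1 ∈ A ∧ x.2.1 ∈ B ∧ x.2.2 ∈ C) ∧
      G.Adj x.1 x.2.1 ∧ G.Adj x.1 x.2.2 ∧ G.Adj x.2.1 x.2.2 := by
  simp [adjTriples]

theorem card_adjPairs_le_sum (A B : Finset (Fin n)) :
    (adjPairs G A B).card ≤ ∑ i ∈ A, (commonNbrs G {i}).card := by
  rw [← Finset.card_sigma]
  refine Finset.card_le_card_of_injOn (fun x => ⟨x.1, x.2⟩) ?_ ?_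
  · intro x hx
    obtain ⟨h1, h2, h3⟩ := mem_adjPairs.1 hx
    simp [mem_commonNbrs, h1, h3]
  · rintro ⟨a, b⟩ _ ⟨c, d⟩ _ h
    simpa using h

theorem card_adjTriples_le_sum (A B C : Finset (Fin n)) :
    (adjTriples G A B C).card ≤ ∑ x ∈ adjPairs G A B, (commonNbrs G {x.1, x.2}).card := by
  rw [← Finset.card_sigma]
  refine Finset.card_le_card_of_injOn (fun x => ⟨(x.1, x.2.1), x.2.2⟩) ?_ ?_
  · intro x hx
    obtain ⟨⟨h1, h2, h3⟩, h4, h5, h6⟩ := mem_adjTriples.1 hx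
    simp [mem_commonNbrs, mem_adjPairs, h1, h2, h4, h5, h6]
  · rintro ⟨a, b, c⟩ _ ⟨a', b', c'⟩ _ h
    simp only [Sigma.mk.injEq, Prod.mk.injEq, heq_eq_eq] at h
    simp [h.1.1, h.1.2, h.2]

open Classical in
theorem card_adjPairs_eq_sum (A C : Finset (Fin n)) :
    (adjPairs G A C).card = ∑ k ∈ C, (A.filter fun i => G.Adj i k).card := by
  rw [← Finset.card_sigma]
  refine Finset.card_bij (fun x _ => ⟨x.2, x.1⟩) ?_ ?_ ?_
  · intro x hx
    obtain ⟨h1, h2, h3⟩ := mem_adjPairs.1 hx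
    simp [h1, h2, h3]
  · rintro ⟨a, b⟩ _ ⟨c, d⟩ _ h
    simp only [Sigma.mk.injEq, heq_eq_eq] at h
    simp [h.1, h.2]
  · rintro ⟨k, i⟩ h
    simp only [Finset.mem_sigma, Finset.mem_filter] at h
    exact ⟨(i, k), mem_adjPairs.2 ⟨h.2.1, h.1, h.2.2⟩, rfl⟩

open Classical in
theorem card_adjTriples_le_sum_adjPairs (A B C : Finset (Fin n)) :
    (adjTriples G A B C).card ≤ ∑ k ∈ C, (adjPairs G (A.filter fun i => G.Adj i k)
      (B.filter fun i => G.Adj i k)).card := by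
  rw [← Finset.card_sigma]
  refine Finset.card_le_card_of_injOn (fun x => ⟨x.2.2, (x.1, x.2.1)⟩) ?_ ?_
  · intro x hx
    obtain ⟨⟨h1, h2, h3⟩, h4, h5, h6⟩ := mem_adjTriples.1 hx
    simp [mem_adjPairs, h1, h2, h3, h4, h5, h6]
  · rintro ⟨a, b, c⟩ _ ⟨a', b', c'⟩ _ h
    simp only [Sigma.mk.injEq, Prod.mk.injEq, heq_eq_eq] at h
    simp [h.1, h.2.1, h.2.2]

theorem IsTypical.card_adjTriples_le_mul (hG : IsTypical G) (A B C : Finset (Fin n)) :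
    ((adjTriples G A B C).card : ℝ) ≤
      (adjPairs G A B).card * (13 * Real.log n * cubeRoot n) := by
  have h1 : ((adjTriples G A B C).card : ℝ) ≤
      ∑ x ∈ adjPairs G A B, ((commonNbrs G {x.1, x.2}).card : ℝ) := by
    exact_mod_cast card_adjTriples_le_sum A B C
  refine h1.trans ?_
  rw [← nsmul_eq_mul, ← Finset.sum_const]
  refine Finset.sum_le_sum fun x hx => ?_
  have hc : ({x.1, x.2} : Finset (Fin n)).card = 2 := Finset.card_pair (mem_adjPairs.1 hx).2.2.ne
  have := hG.card_commonNbrs_le {x.1, x.2} (by omega)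
  rw [hc] at this
  simpa using this

theorem IsTypical.card_adjPairs_le_mul (hG : IsTypical G) (A B : Finset (Fin n)) :
    ((adjPairs G A B).card : ℝ) ≤ A.card * (13 * Real.log n * cubeRoot n ^ 2) := by
  have h1 : ((adjPairs G A B).card : ℝ) ≤ ∑ i ∈ A, ((commonNbrs G {i}).card : ℝ) := by
    exact_mod_cast card_adjPairs_le_sum A B
  refine h1.trans ?_
  rw [← nsmul_eq_mul, ← Finset.sum_const]
  refine Finset.sum_le_sum fun i _ => ?_
  simpa using hG.card_commonNbrs_le {i} (by simp)

theorem IsTypical.card_adjPairs_le_sq (hG : IsTypical G) (hn : 0 < n) {A B : Finset (Fin n)}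
    {α β : ℝ} (hA : (A.card : ℝ) ≤ α ^ 2) (hB : (B.card : ℝ) ≤ β ^ 2) :
    ((adjPairs G A B).card : ℝ) ≤
      18 * Real.log n * (α ^ 2 * β ^ 2 / cubeRoot n + α ^ 2 + β ^ 2) := by
  have hθ := one_le_cubeRoot hn
  have hL : 0 ≤ Real.log n := Real.log_natCast_nonneg n
  refine (hG.card_adjPairs_le A B).trans ?_
  gcongr

/-- The bound `γ^2 α β` is, up to a constant, the reciprocal of the weight later given to a triangle
with vertices at these levels. Three regimes occur, according to which of the edge, neighbourhood
and degree estimates is effective. -/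
theorem IsTypical.card_adjTriples_le (hG : IsTypical G) (hn : 0 < n) {A B C : Finset (Fin n)}
    {α β γ : ℝ} (h1 : 1 ≤ α) (hαβ : α ≤ β) (hβγ : β ≤ γ) (hA : (A.card : ℝ) ≤ α ^ 2)
    (hB : (B.card : ℝ) ≤ β ^ 2) (hC : (C.card : ℝ) ≤ γ ^ 2) :
    ((adjTriples G A B C).card : ℝ) ≤ 3888 * Real.log n ^ 2 * (γ ^ 2 * (α * β)) := by
  classical
  have hθ1 := one_le_cubeRoot hn
  have hL : 0 ≤ Real.log n := Real.log_natCast_nonneg n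
  have hT := hG.card_adjTriples_le_mul A B C
  have hAB := hG.card_adjPairs_le_sq hn hA hB
  have hAC := hG.card_adjPairs_le_sq hn hA hC
  have hBC := hG.card_adjPairs_le_sq hn hB hC
  have hdeg := hG.card_adjPairs_le_mul A B
  have hpair := hG.card_adjPairs_le
  generalize cubeRoot n = θ at *
  generalize Real.log n = L at *
  have hθ : 0 < θ := by linarith
  have hα : 0 < α := by linarith
  have hβ : 0 < β := by linarith
  have hγ : 0 < γ := by linarith
  have hαβγ : α * β ≤ γ ^ 2 := by nlinarith
  have hαβ2 : α ^ 2 ≤ β ^ 2 := pow_le_pow_left₀ hα.le hαβ 2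
  have hβγ2 : β ^ 2 ≤ γ ^ 2 := pow_le_pow_left₀ hβ.le hβγ 2
  have hL2 : 0 ≤ L ^ 2 := by positivity
  have hP : 0 ≤ γ ^ 2 * (α * β) := by positivity
  rcases le_or_gt θ (α ^ 2) with hcase | hcase
  -- `A` may be large here: count edges between `A` and `B`, then extend each by a common neighbour.
  · have e1 : α ^ 2 * β ^ 2 ≤ γ ^ 2 * (α * β) := by
      calc α ^ 2 * β ^ 2 = (α * β) * (α * β) := by ring
        _ ≤ γ ^ 2 * (α * β) := by gcongr
    have e2 : θ * β ^ 2 ≤ γ ^ 2 * (α * β) := by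
      calc θ * β ^ 2 ≤ α ^ 2 * β ^ 2 := by gcongr
        _ ≤ γ ^ 2 * (α * β) := e1
    calc ((adjTriples G A B C).card : ℝ)
        ≤ 18 * L * (α ^ 2 * β ^ 2 / θ + α ^ 2 + β ^ 2) * (13 * L * θ) :=
          hT.trans (by gcongr)
      _ = 234 * L ^ 2 * (α ^ 2 * β ^ 2 + θ * α ^ 2 + θ * β ^ 2) := by
          field_simp
          ring
      _ ≤ 234 * L ^ 2 * (γ ^ 2 * (α * β) + γ ^ 2 * (α * β) + γ ^ 2 * (α * β)) := by
          have e3 : θ * α ^ 2 ≤ γ ^ 2 * (α * β) :=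
            (mul_le_mul_of_nonneg_left hαβ2 hθ.le).trans e2
          exact mul_le_mul_of_nonneg_left (by linarith) (by positivity)
      _ = 702 * (L ^ 2 * (γ ^ 2 * (α * β))) := by ring
      _ ≤ 3888 * (L ^ 2 * (γ ^ 2 * (α * β))) := by
          gcongr
          norm_num
      _ = _ := by ring
  · rcases le_or_gt β (α * θ) with hcase' | hcase'
    -- Now `|A| ≤ θ`, so inside the neighbourhood of a fixed `k` the term `|A'||B'|/θ` is at most
    -- `|B'|`. Summing the linear terms over `k ∈ C` gives edge counts between `A`, `C` and between
    -- `B`, `C`.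
    · have hk : ∀ k ∈ C, ((adjPairs G (A.filter fun i => G.Adj i k)
          (B.filter fun i => G.Adj i k)).card : ℝ) ≤
          36 * L * ((A.filter fun i => G.Adj i k).card + (B.filter fun i => G.Adj i k).card) := by
        intro k _
        refine (hpair _ _).trans ?_
        have ha : ((A.filter fun i => G.Adj i k).card : ℝ) ≤ θ := by
          have : ((A.filter fun i => G.Adj i k).card : ℝ) ≤ A.card := by
            exact_mod_cast Finset.card_filter_le _ _
          linarith
        have hab : ((A.filter fun i => G.Adj i k).card : ℝ) * (B.filter fun i => G.Adj i k).card / θ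
            ≤ (B.filter fun i => G.Adj i k).card := by
          rw [div_le_iff₀ hθ, mul_comm]
          gcongr
        have ha0 : (0 : ℝ) ≤ (A.filter fun i => G.Adj i k).card := by positivity
        calc _ ≤ 18 * L * (2 * ((A.filter fun i => G.Adj i k).card +
              (B.filter fun i => G.Adj i k).card)) := by
              gcongr
              linarith
          _ = _ := by ring
      have e1 : β ^ 2 * γ ^ 2 / θ ≤ γ ^ 2 * (α * β) := by
        rw [div_le_iff₀ hθ]
        calc β ^ 2 * γ ^ 2 = γ ^ 2 * β * β := by ring
          _ ≤ γ ^ 2 * β * (α * θ) := by gcongr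
          _ = _ := by ring
      have e2 : α ^ 2 * γ ^ 2 / θ ≤ γ ^ 2 * (α * β) := le_trans (by gcongr) e1
      have e3 : γ ^ 2 ≤ γ ^ 2 * (α * β) := le_mul_of_one_le_right (by positivity) (by nlinarith)
      calc ((adjTriples G A B C).card : ℝ)
          ≤ ∑ k ∈ C, ((adjPairs G (A.filter fun i => G.Adj i k)
            (B.filter fun i => G.Adj i k)).card : ℝ) := by
            exact_mod_cast card_adjTriples_le_sum_adjPairs A B C
        _ ≤ ∑ k ∈ C, 36 * L * (((A.filter fun i => G.Adj i k).card : ℝ) +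
            (B.filter fun i => G.Adj i k).card) := Finset.sum_le_sum hk
        _ = 36 * L * ((adjPairs G A C).card + (adjPairs G B C).card) := by
            rw [← Finset.mul_sum, Finset.sum_add_distrib, card_adjPairs_eq_sum,
              card_adjPairs_eq_sum]
            push_cast
            rfl
        _ ≤ 36 * L * (18 * L * (α ^ 2 * γ ^ 2 / θ + α ^ 2 + γ ^ 2) +
            18 * L * (β ^ 2 * γ ^ 2 / θ + β ^ 2 + γ ^ 2)) := by gcongr
        _ = 648 * L ^ 2 * (α ^ 2 * γ ^ 2 / θ + α ^ 2 + γ ^ 2 +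
            (β ^ 2 * γ ^ 2 / θ + β ^ 2 + γ ^ 2)) := by ring
        _ ≤ 648 * L ^ 2 * (6 * (γ ^ 2 * (α * β))) := by
            gcongr
            linarith
        _ = _ := by ring
    -- `B` is so much larger than `A` that bounding degrees by `L θ^2` and codegrees by `L θ` is
    -- enough.
    · have e1 : α ^ 2 * θ ^ 3 ≤ γ ^ 2 * (α * β) := by
        calc α ^ 2 * θ ^ 3 ≤ α ^ 4 * θ ^ 3 := by
              gcongr
              norm_num
          _ = (α * θ) ^ 2 * (α * (α * θ)) := by ring
          _ ≤ γ ^ 2 * (α * β) := by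
              have : α * θ ≤ γ := hcase'.le.trans hβγ
              gcongr
      calc ((adjTriples G A B C).card : ℝ) ≤ α ^ 2 * (13 * L * θ ^ 2) * (13 * L * θ) :=
            hT.trans (by gcongr; exact hdeg.trans (by gcongr))
        _ = 169 * L ^ 2 * (α ^ 2 * θ ^ 3) := by ring
        _ ≤ 3888 * L ^ 2 * (γ ^ 2 * (α * β)) := by
            gcongr
            norm_num

end triangles

/-- Dyadic levels of the coordinates of a unit vector, truncated at `n^{-1/2}`. -/
theorem exists_dyadic_levels {n : ℕ} (hn : 0 < n) (x : Fin n → ℝ) (hx : ∑ i, x i ^ 2 = 1) :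
    ∃ t : Fin n → ℕ, (∀ i, |x i| ≤ (2 ^ t i)⁻¹) ∧ (∀ i, (t i : ℝ) ≤ Real.log n) ∧
      ∀ k, ((Finset.univ.filter fun i => t i = k).card : ℝ) ≤ (3 * 2 ^ k) ^ 2 := by
  have hnR : (1 : ℝ) ≤ n := by exact_mod_cast hn
  have hs1 : 1 ≤ √(n : ℝ) := Real.one_le_sqrt.2 hnR
  have hs0 : 0 < √(n : ℝ) := by linarith
  have hx1 : ∀ i, |x i| ≤ 1 := by
    intro i
    rw [← sq_le_one_iff_abs_le_one, ← hx]
    exact Finset.single_le_sum (f := fun i => x i ^ 2) (fun j _ => sq_nonneg _) (Finset.mem_univ i)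
  -- Truncating below at `n^{-1/2}` adds at most 1 to the sum of squares and keeps every level below
  -- `log n`. Since `2^{-t} ≤ 2y`, the squares `4^{-t}` sum to at most 8, rounded up to `3^2`.
  let y : Fin n → ℝ := fun i => max |x i| (√(n : ℝ))⁻¹
  have hy0 : ∀ i, 0 < y i := fun i => lt_max_of_lt_right (by positivity)
  have hy1 : ∀ i, y i ≤ 1 := fun i => max_le (hx1 i) (inv_le_one_of_one_le₀ hs1)
  have hex : ∀ i, ∃ t : ℕ, (2 : ℝ) ^ t ≤ (y i)⁻¹ ∧ (y i)⁻¹ < 2 ^ (t + 1) := fun i =>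
    exists_nat_pow_near (one_le_inv₀ (hy0 i) |>.2 (hy1 i)) one_lt_two
  choose t ht1 ht2 using hex
  have hysq : ∀ i, y i ^ 2 ≤ x i ^ 2 + (n : ℝ)⁻¹ := by
    intro i
    have h : ((√(n : ℝ))⁻¹) ^ 2 = (n : ℝ)⁻¹ := by
      rw [inv_pow, Real.sq_sqrt (by linarith)]
    rcases max_choice |x i| (√(n : ℝ))⁻¹ with hm | hm
    · simp only [y, hm, sq_abs]
      have : 0 ≤ (n : ℝ)⁻¹ := by positivity
      linarith
    · simp only [y, hm, h]
      have := sq_nonneg (x i)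
      linarith
  have hlev : ∀ i, ((2 : ℝ) ^ t i)⁻¹ ^ 2 ≤ 4 * (x i ^ 2 + (n : ℝ)⁻¹) := by
    intro i
    have h1 : ((2 : ℝ) ^ t i)⁻¹ ≤ 2 * y i := by
      rw [inv_le_comm₀ (by positivity) (by linarith [hy0 i]), mul_inv]
      have := (ht2 i).le
      rw [pow_succ] at this
      linarith
    calc ((2 : ℝ) ^ t i)⁻¹ ^ 2 ≤ (2 * y i) ^ 2 := pow_le_pow_left₀ (by positivity) h1 2
      _ = 4 * y i ^ 2 := by ring
      _ ≤ _ := by linarith [hysq i]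
  refine ⟨t, fun i => ?_, fun i => ?_, fun k => ?_⟩
  · refine (le_max_left |x i| (√(n : ℝ))⁻¹).trans ?_
    change y i ≤ _
    rw [le_inv_comm₀ (hy0 i) (by positivity)]
    exact ht1 i
  · have h1 : (2 : ℝ) ^ t i ≤ √(n : ℝ) := by
      refine (ht1 i).trans ?_
      rw [inv_le_comm₀ (hy0 i) hs0]
      exact le_max_right _ _
    have h2 := Real.log_le_log (by positivity) h1
    rw [Real.log_pow, Real.log_sqrt (by linarith)] at h2
    have h3 := Real.log_two_gt_d9
    have h4 : (0 : ℝ) ≤ t i := by positivity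
    nlinarith
  · have h1 : ∑ i, ((2 : ℝ) ^ t i)⁻¹ ^ 2 ≤ 8 := by
      calc ∑ i, ((2 : ℝ) ^ t i)⁻¹ ^ 2 ≤ ∑ i, 4 * (x i ^ 2 + (n : ℝ)⁻¹) :=
            Finset.sum_le_sum fun i _ => hlev i
        _ = 8 := by
            rw [← Finset.mul_sum, Finset.sum_add_distrib, hx, Finset.sum_const, Finset.card_fin,
              nsmul_eq_mul, mul_inv_cancel₀ (by linarith)]
            norm_num
    have h2 : ∑ i ∈ Finset.univ.filter fun i => t i = k, ((2 : ℝ) ^ t i)⁻¹ ^ 2 ≤ 8 :=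
      (Finset.sum_le_sum_of_subset_of_nonneg (Finset.filter_subset _ _)
        fun i _ _ => by positivity).trans h1
    rw [Finset.sum_congr rfl fun i hi => by rw [(Finset.mem_filter.1 hi).2], Finset.sum_const,
      nsmul_eq_mul, inv_pow, ← div_eq_mul_inv, div_le_iff₀ (by positivity)] at h2
    refine h2.trans ?_
    rw [mul_pow]
    gcongr
    norm_num

theorem exists_sorted_enumeration_four {n : ℕ} (t : Fin n → ℕ) (s : Finset (Fin n))
    (hs : s.card = 4) : ∃ i j k l : Fin n, s = {i, j, k, l} ∧ [i, j, k, l].Nodup ∧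
      t i ≤ t j ∧ t j ≤ t k ∧ t k ≤ t l := by
  classical
  let e := s.orderEmbOfFin hs
  let σ := Tuple.sort (t ∘ e)
  have hm : Monotone ((t ∘ e) ∘ σ) := Tuple.monotone_sort (t ∘ e)
  let v : Fin 4 → Fin n := e ∘ σ
  have hinj : Function.Injective v := e.injective.comp σ.injective
  have hs' : s = Finset.univ.image v := by
    rw [← Finset.image_image, Finset.image_univ_of_surjective σ.surjective, Finset.image_orderEmbOfFin_univ]
  refine ⟨v 0, v 1, v 2, v 3, ?_, ?_, hm (by decide), hm (by decide), hm (by decide)⟩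
  · rw [hs']
    ext a
    simp [Fin.exists_fin_succ, eq_comm]
  · simp [hinj.eq_iff]


open Classical in
theorem eval_cliquePoly {n : ℕ} (G : SimpleGraph (Fin n)) (x : Fin n → ℝ) :
    MvPolynomial.eval x (cliquePoly G) = ∑ s ∈ G.cliqueFinset 4, ∏ i ∈ s, x i := by
  simp [cliquePoly, map_sum, map_prod]

/-- A weighted count of triangles whose vertices are ordered by dyadic level. -/
theorem IsTypical.sum_adjTriples_le {n : ℕ} {G : SimpleGraph (Fin n)} (hG : IsTypical G)
    (hn : 3 ≤ n) (t : Fin n → ℕ) (htL : ∀ i, (t i : ℝ) ≤ Real.log n)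
    (ht : ∀ k, ((Finset.univ.filter fun i => t i = k).card : ℝ) ≤ (3 * 2 ^ k) ^ 2) :
    ∑ x ∈ (adjTriples G Finset.univ Finset.univ Finset.univ).filter
        (fun x => t x.1 ≤ t x.2.1 ∧ t x.2.1 ≤ t x.2.2),
      ((2 : ℝ) ^ t x.1 * 2 ^ t x.2.1 * (2 ^ t x.2.2) ^ 2)⁻¹ ≤ 2519424 * Real.log n ^ 5 := by
  classical
  have hL := one_le_log hn
  let m := ⌊Real.log n⌋₊ + 1
  have hm : (m : ℝ) ≤ 2 * Real.log n := by
    have := Nat.floor_le (by linarith : 0 ≤ Real.log n)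
    push_cast [m]
    linarith
  have htm : ∀ i, t i ∈ Finset.range m := fun i =>
    Finset.mem_range.2 (Nat.lt_succ_of_le (Nat.le_floor (htL i)))
  let Q := (adjTriples G Finset.univ Finset.univ Finset.univ).filter
        (fun x => t x.1 ≤ t x.2.1 ∧ t x.2.1 ≤ t x.2.2)
  let R := Finset.range m ×ˢ Finset.range m ×ˢ Finset.range m
  let lev : Fin n × Fin n × Fin n → ℕ × ℕ × ℕ := fun x => (t x.1, t x.2.1, t x.2.2)
  have hmaps : ∀ x ∈ Q, lev x ∈ R := fun x _ => by
    simp only [R, lev, Finset.mem_product]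
    exact ⟨htm _, htm _, htm _⟩
  change ∑ x ∈ Q, _ ≤ _
  rw [← Finset.sum_fiberwise_of_maps_to hmaps]
  -- Within one triple of levels the weight cancels the triangle count, leaving `3888 · 3^4 · L^2`;
  -- there are at most `(2L)^3` triples of levels.
  have hfib : ∀ r ∈ R, ∑ x ∈ Q.filter (fun x => lev x = r),
      ((2 : ℝ) ^ t x.1 * 2 ^ t x.2.1 * (2 ^ t x.2.2) ^ 2)⁻¹ ≤ 314928 * Real.log n ^ 2 := by
    rintro ⟨a, b, c⟩ _
    by_cases habc : a ≤ b ∧ b ≤ c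
    · have hsub : Q.filter (fun x => lev x = (a, b, c)) ⊆ adjTriples G
          (Finset.univ.filter fun i => t i = a) (Finset.univ.filter fun i => t i = b)
          (Finset.univ.filter fun i => t i = c) := by
        intro x hx
        simp only [Q, lev, Finset.mem_filter, mem_adjTriples, Prod.mk.injEq] at hx
        simp only [mem_adjTriples, Finset.mem_filter, Finset.mem_univ, true_and]
        exact ⟨hx.2, hx.1.1.2⟩
      have hcard : ((Q.filter (fun x => lev x = (a, b, c))).card : ℝ) ≤
          3888 * Real.log n ^ 2 * ((3 * 2 ^ c) ^ 2 * ((3 * 2 ^ a) * (3 * 2 ^ b))) := by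
        refine (Nat.cast_le.2 (Finset.card_le_card hsub)).trans ?_
        refine hG.card_adjTriples_le (by omega) ?_ ?_ ?_ (ht a) (ht b) (ht c)
        · have : (1 : ℝ) ≤ 2 ^ a := one_le_pow₀ one_le_two
          linarith
        · gcongr
          · norm_num
          · exact habc.1
        · gcongr
          · norm_num
          · exact habc.2
      have hconst : ∀ x ∈ Q.filter (fun x => lev x = (a, b, c)),
          ((2 : ℝ) ^ t x.1 * 2 ^ t x.2.1 * (2 ^ t x.2.2) ^ 2)⁻¹ =
            ((2 : ℝ) ^ a * 2 ^ b * (2 ^ c) ^ 2)⁻¹ := by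
        intro x hx
        simp only [lev, Finset.mem_filter, Prod.mk.injEq] at hx
        rw [hx.2.1, hx.2.2.1, hx.2.2.2]
      rw [Finset.sum_congr rfl hconst, Finset.sum_const, nsmul_eq_mul, ← div_eq_mul_inv,
        div_le_iff₀ (by positivity)]
      refine hcard.trans (le_of_eq ?_)
      ring
    · rw [Finset.sum_eq_zero]
      · positivity
      · intro x hx
        simp only [Q, lev, Finset.mem_filter, Prod.mk.injEq] at hx
        obtain ⟨⟨_, h1, h2⟩, rfl, rfl, rfl⟩ := hx
        exact absurd ⟨h1, h2⟩ habc
  calc _ ≤ ∑ r ∈ R, 314928 * Real.log n ^ 2 := Finset.sum_le_sum hfib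
    _ = m ^ 3 * (314928 * Real.log n ^ 2) := by
        rw [Finset.sum_const, nsmul_eq_mul]
        simp only [R, Finset.card_product, Finset.card_range]
        push_cast
        ring
    _ ≤ (2 * Real.log n) ^ 3 * (314928 * Real.log n ^ 2) := by gcongr
    _ = _ := by ring

theorem IsTypical.abs_eval_cliquePoly_le {n : ℕ} {G : SimpleGraph (Fin n)} (hG : IsTypical G)
    (hn : 3 ≤ n) (x : Fin n → ℝ) (hx : ∑ i, x i ^ 2 = 1) :
    |MvPolynomial.eval x (cliquePoly G)| ≤ 32752512 * Real.log n ^ 6 := by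
  classical
  have hL := one_le_log hn
  obtain ⟨t, ht1, htL, ht⟩ := exists_dyadic_levels (by omega) x hx
  have hsum := hG.sum_adjTriples_le hn t htL ht
  have henum : ∀ s : Finset (Fin n), s.card = 4 → ∃ y : (Fin n × Fin n × Fin n) × Fin n,
      s = {y.1.1, y.1.2.1, y.1.2.2, y.2} ∧ [y.1.1, y.1.2.1, y.1.2.2, y.2].Nodup ∧
      t y.1.1 ≤ t y.1.2.1 ∧ t y.1.2.1 ≤ t y.1.2.2 ∧ t y.1.2.2 ≤ t y.2 := by
    intro s hs
    obtain ⟨i, j, k, l, h⟩ := exists_sorted_enumeration_four t s hs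
    exact ⟨((i, j, k), l), h⟩
  have : Nonempty (Fin n) := ⟨⟨0, by omega⟩⟩
  choose! φ hφ using henum
  have hc4 : ∀ s ∈ G.cliqueFinset 4, s.card = 4 := fun s hs =>
    (SimpleGraph.mem_cliqueFinset_iff.1 hs).2
  let Q := (adjTriples G Finset.univ Finset.univ Finset.univ).filter
        (fun x => t x.1 ≤ t x.2.1 ∧ t x.2.1 ≤ t x.2.2)
  let w : Fin n × Fin n × Fin n → ℝ := fun x =>
    ((2 : ℝ) ^ t x.1 * 2 ^ t x.2.1 * (2 ^ t x.2.2) ^ 2)⁻¹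
  let P := (Q ×ˢ (Finset.univ : Finset (Fin n))).filter
    fun y => y.2 ∈ commonNbrs G {y.1.1, y.1.2.1, y.1.2.2}
  have hw0 : ∀ x, 0 ≤ w x := fun x => by positivity
  have hterm : ∀ s ∈ G.cliqueFinset 4, |∏ i ∈ s, x i| ≤ w (φ s).1 := by
    intro s hs
    obtain ⟨h1, h2, h3, h4, h5⟩ := hφ s (hc4 s hs)
    generalize φ s = y at *
    obtain ⟨⟨i, j, k⟩, l⟩ := y
    simp only [List.nodup_cons, List.mem_cons, List.not_mem_nil, or_false, not_or] at h2
    obtain ⟨⟨hij, hik, hil⟩, ⟨hjk, hjl⟩, hkl, -⟩ := h2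
    rw [Finset.abs_prod]
    calc ∏ a ∈ s, |x a| ≤ ∏ a ∈ s, ((2 : ℝ) ^ t a)⁻¹ :=
          Finset.prod_le_prod (fun a _ => abs_nonneg _) fun a _ => ht1 a
      _ = (2 ^ t i)⁻¹ * ((2 ^ t j)⁻¹ * ((2 ^ t k)⁻¹ * (2 ^ t l)⁻¹)) := by
          rw [h1]
          rw [Finset.prod_insert (by simp [hij, hik, hil]), Finset.prod_insert (by simp [hjk, hjl]),
            Finset.prod_insert (by simp [hkl]), Finset.prod_singleton]
      -- The last vertex has the highest level, hence the smallest bound; replacing it by the third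
      -- makes the weight independent of `l`, which can then be summed out.
      _ ≤ (2 ^ t i)⁻¹ * ((2 ^ t j)⁻¹ * ((2 ^ t k)⁻¹ * (2 ^ t k)⁻¹)) := by
          gcongr
          norm_num
      _ = w (i, j, k) := by
          simp only [w, mul_inv]
          ring
  have hinj : Set.InjOn φ (G.cliqueFinset 4) := by
    intro s hs s' hs' h
    rw [(hφ s (hc4 s hs)).1, (hφ s' (hc4 s' hs')).1, h]
  have himage : (G.cliqueFinset 4).image φ ⊆ P := by
    intro y hy
    obtain ⟨s, hs, rfl⟩ := Finset.mem_image.1 hy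
    obtain ⟨h1, h2, h3, h4, h5⟩ := hφ s (hc4 s hs)
    have hcl := (SimpleGraph.mem_cliqueFinset_iff.1 hs).1
    generalize φ s = y at *
    obtain ⟨⟨i, j, k⟩, l⟩ := y
    simp only [List.nodup_cons, List.mem_cons, List.not_mem_nil, or_false, not_or] at h2
    obtain ⟨⟨hij, hik, hil⟩, ⟨hjk, hjl⟩, hkl, -⟩ := h2
    have hadj : ∀ a ∈ s, ∀ b ∈ s, a ≠ b → G.Adj a b := fun a ha b hb hab => hcl ha hb hab
    simp only [P, Q, Finset.mem_filter, Finset.mem_product, Finset.mem_univ, and_true,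
      mem_adjTriples, true_and, mem_commonNbrs]
    have hi : i ∈ s := by simp [h1]
    have hj : j ∈ s := by simp [h1]
    have hk : k ∈ s := by simp [h1]
    have hl : l ∈ s := by simp [h1]
    refine ⟨⟨⟨hadj i hi j hj hij, hadj i hi k hk hik, hadj j hj k hk hjk⟩, h3, h4⟩, ?_⟩
    intro v hv
    simp only [Finset.mem_insert, Finset.mem_singleton] at hv
    rcases hv with rfl | rfl | rfl
    · exact hadj _ hi _ hl hil
    · exact hadj _ hj _ hl hjl
    · exact hadj _ hk _ hl hkl
  rw [eval_cliquePoly]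
  calc |∑ s ∈ G.cliqueFinset 4, ∏ i ∈ s, x i| ≤ ∑ s ∈ G.cliqueFinset 4, |∏ i ∈ s, x i| :=
        Finset.abs_sum_le_sum_abs _ _
    _ ≤ ∑ s ∈ G.cliqueFinset 4, w (φ s).1 := Finset.sum_le_sum hterm
    _ = ∑ y ∈ (G.cliqueFinset 4).image φ, w y.1 := 
        (Finset.sum_image (f := fun y => w y.1) hinj).symm
    _ ≤ ∑ y ∈ P, w y.1 := Finset.sum_le_sum_of_subset_of_nonneg himage fun y _ _ => hw0 _
    _ = ∑ z ∈ Q, ((commonNbrs G {z.1, z.2.1, z.2.2}).card : ℝ) * w z := by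
        rw [Finset.sum_filter, Finset.sum_product]
        refine Finset.sum_congr rfl fun z _ => ?_
        rw [← Finset.sum_filter]
        change ∑ a ∈ Finset.univ.filter (fun a => a ∈ commonNbrs G {z.1, z.2.1, z.2.2}), w z = _
        rw [Finset.sum_const, nsmul_eq_mul, Finset.filter_univ_mem]
    _ ≤ ∑ z ∈ Q, (13 * Real.log n) * w z := by
        refine Finset.sum_le_sum fun z hz => mul_le_mul_of_nonneg_right ?_ (hw0 z)
        simp only [Q, Finset.mem_filter, mem_adjTriples] at hz
        have hc : ({z.1, z.2.1, z.2.2} : Finset (Fin n)).card = 3 :=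
          Finset.card_eq_three.2 ⟨_, _, _, hz.1.2.1.ne, hz.1.2.2.1.ne, hz.1.2.2.2.ne, rfl⟩
        have := hG.card_commonNbrs_le _ hc.le
        rw [hc] at this
        simpa using this
    _ ≤ (13 * Real.log n) * (2519424 * Real.log n ^ 5) := by
        rw [← Finset.mul_sum]
        gcongr
    _ = _ := by ring

/-! ### Matrix representations -/

section matrixRep

variable {n : ℕ}

/-- The exponent of the monomial `x^{⊗k}_I`. -/
noncomputable def tupleExponent {k : ℕ} (I : Fin k → Fin n) : Fin n →₀ ℕ :=
  ∑ l, Finsupp.single (I l) 1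

theorem tupleExponent_apply {k : ℕ} (I : Fin k → Fin n) (v : Fin n) :
    tupleExponent I v = (Finset.univ.filter fun l => I l = v).card := by
  simp [tupleExponent, Finsupp.finsetSum_apply, Finsupp.single_apply]

theorem eval_monomial_tupleExponent {k : ℕ} (x : Fin n → ℝ) (I J : Fin k → Fin n) (c : ℝ) :
    MvPolynomial.eval x (MvPolynomial.monomial (tupleExponent I + tupleExponent J) c) =
      tensorPower k x I * (c * tensorPower k x J) := by
  have h : ∀ I : Fin k → Fin n,
      MvPolynomial.monomial (tupleExponent I) (1 : ℝ) = ∏ l, MvPolynomial.X (I l) := by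
    intro I
    rw [tupleExponent, MvPolynomial.monomial_sum_one]
    rfl
  have h2 : MvPolynomial.monomial (tupleExponent I + tupleExponent J) c =
      MvPolynomial.C c * (MvPolynomial.monomial (tupleExponent I) 1 *
        MvPolynomial.monomial (tupleExponent J) 1) := by
    rw [MvPolynomial.monomial_mul, MvPolynomial.C_mul_monomial]
    simp
  rw [h2, h, h]
  simp only [map_mul, MvPolynomial.eval_C, map_prod, MvPolynomial.eval_X, tensorPower]
  ring

theorem dotProduct_mulVec_tensorPower {k : ℕ}
    (M : Matrix (Fin k → Fin n) (Fin k → Fin n) ℝ) (x : Fin n → ℝ) :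
    tensorPower k x ⬝ᵥ M.mulVec (tensorPower k x) = MvPolynomial.eval x
      (∑ I, ∑ J, MvPolynomial.monomial (tupleExponent I + tupleExponent J) (M I J)) := by
  simp only [map_sum, eval_monomial_tupleExponent, dotProduct, Matrix.mulVec, Finset.mul_sum]

/-- Over the infinite field `ℝ`, equality of values forces equality of polynomials, so coefficients
of `h` can be read off from `M`. -/
theorem IsMatrixRep.eq_sum {d : ℕ} {h : MvPolynomial (Fin n) ℝ}
    {M : Matrix (Fin (d / 2) → Fin n) (Fin (d / 2) → Fin n) ℝ} (hM : IsMatrixRep d h M) :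
    h = ∑ I, ∑ J, MvPolynomial.monomial (tupleExponent I + tupleExponent J) (M I J) :=
  MvPolynomial.funext fun x => by rw [← hM.2 x, dotProduct_mulVec_tensorPower]

theorem eval_one_eq_sum_coeff (h : MvPolynomial (Fin n) ℝ) :
    MvPolynomial.eval (fun _ => 1) h = ∑ α ∈ h.support, h.coeff α := by
  simp [MvPolynomial.eval_eq]

open Classical in
theorem IsMatrixRep.sum_support {d : ℕ} {h : MvPolynomial (Fin n) ℝ}
    {M : Matrix (Fin (d / 2) → Fin n) (Fin (d / 2) → Fin n) ℝ} (hM : IsMatrixRep d h M) :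
    ∑ x ∈ Finset.univ.filter (fun x : (Fin (d / 2) → Fin n) × (Fin (d / 2) → Fin n) =>
      tupleExponent x.1 + tupleExponent x.2 ∈ h.support), M x.1 x.2 =
      MvPolynomial.eval (fun _ => 1) h := by
  have hcoeff : ∀ α, h.coeff α = ∑ x : (Fin (d / 2) → Fin n) × (Fin (d / 2) → Fin n),
      if tupleExponent x.1 + tupleExponent x.2 = α then M x.1 x.2 else 0 := by
    intro α
    conv_lhs => rw [hM.eq_sum]
    simp only [MvPolynomial.coeff_sum, MvPolynomial.coeff_monomial]
    rw [← Finset.univ_product_univ, Finset.sum_product]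
  rw [eval_one_eq_sum_coeff]
  simp_rw [hcoeff]
  rw [Finset.sum_comm, Finset.sum_filter]
  refine Finset.sum_congr rfl fun x _ => ?_
  rw [Finset.sum_ite_eq]

/-- By symmetry a row is a column, which is the image of a basis vector. -/
theorem sum_sq_row_le {ι : Type*} [Fintype ι] [DecidableEq ι] {M : Matrix ι ι ℝ} (hM : M.IsSymm)
    (i : ι) : ∑ j, M i j ^ 2 ≤ ‖Matrix.toEuclideanCLM (𝕜 := ℝ) M‖ ^ 2 := by
  have h1 := (Matrix.toEuclideanCLM (𝕜 := ℝ) M).le_opNorm (EuclideanSpace.single i (1 : ℝ))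
  rw [show ‖EuclideanSpace.single i (1 : ℝ)‖ = 1 by simp, mul_one] at h1
  have h2 : ‖Matrix.toEuclideanCLM (𝕜 := ℝ) M (EuclideanSpace.single i (1 : ℝ))‖ ^ 2 =
      ∑ j, M i j ^ 2 := by
    rw [EuclideanSpace.norm_sq_eq]
    refine Finset.sum_congr rfl fun j _ => ?_
    have : (Matrix.toEuclideanCLM (𝕜 := ℝ) M (EuclideanSpace.single i (1 : ℝ))) j = M j i := by
      rw [Matrix.ofLp_toEuclideanCLM]
      simp
    rw [this, ← hM.apply, Real.norm_eq_abs, sq_abs]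
  rw [← h2]
  exact pow_le_pow_left₀ (norm_nonneg _) h1 2

open Classical in
/-- Cauchy–Schwarz lower bound for the norm of a matrix representation: `R` contains the rows of the
entries whose monomial occurs in `h`. -/
theorem IsMatrixRep.sq_eval_one_le {d : ℕ} {h : MvPolynomial (Fin n) ℝ}
    {M : Matrix (Fin (d / 2) → Fin n) (Fin (d / 2) → Fin n) ℝ} (hM : IsMatrixRep d h M)
    (R : Finset (Fin (d / 2) → Fin n))
    (hR : ∀ I J : Fin (d / 2) → Fin n, tupleExponent I + tupleExponent J ∈ h.support → I ∈ R) :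
    MvPolynomial.eval (fun _ => 1) h ^ 2 ≤
      (Finset.univ.filter (fun x : (Fin (d / 2) → Fin n) × (Fin (d / 2) → Fin n) =>
        tupleExponent x.1 + tupleExponent x.2 ∈ h.support)).card *
      (R.card * ‖Matrix.toEuclideanCLM (𝕜 := ℝ) M‖ ^ 2) := by
  rw [← hM.sum_support]
  refine (sq_sum_le_card_mul_sum_sq).trans ?_
  gcongr
  calc _ ≤ ∑ x ∈ R ×ˢ (Finset.univ : Finset (Fin (d / 2) → Fin n)), M x.1 x.2 ^ 2 := by
        refine Finset.sum_le_sum_of_subset_of_nonneg ?_ fun _ _ _ => sq_nonneg _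
        intro x hx
        simpa using hR x.1 x.2 (Finset.mem_filter.1 hx).2
    _ = ∑ I ∈ R, ∑ J, M I J ^ 2 := Finset.sum_product _ _ _
    _ ≤ ∑ I ∈ R, ‖Matrix.toEuclideanCLM (𝕜 := ℝ) M‖ ^ 2 :=
        Finset.sum_le_sum fun I _ => sum_sq_row_le hM.1 I
    _ = _ := by rw [Finset.sum_const, nsmul_eq_mul]

theorem exists_tupleExponent_eq (k : ℕ) (α : Fin n →₀ ℕ) (hα : α.degree = k) :
    ∃ I : Fin k → Fin n, tupleExponent I = α := by
  induction k generalizing α with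
  | zero =>
    refine ⟨Fin.elim0, ?_⟩
    rw [(Finsupp.degree_eq_zero_iff α).1 hα]
    simp [tupleExponent]
  | succ k ih =>
    have hne : α ≠ 0 := by
      rintro rfl
      simp at hα
    obtain ⟨i, hi⟩ := Finsupp.ne_iff.1 hne
    have hle : Finsupp.single i 1 ≤ α := by
      rw [Finsupp.single_le_iff]
      exact Nat.one_le_iff_ne_zero.2 hi
    have hsplit : Finsupp.single i 1 + (α - Finsupp.single i 1) = α := add_tsub_cancel_of_le hle
    obtain ⟨I, hI⟩ := ih (α - Finsupp.single i 1) (by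
      have h := congrArg Finsupp.degree hsplit
      rw [map_add, Finsupp.degree_single, hα] at h
      omega)
    refine ⟨Fin.cons i I, ?_⟩
    rw [tupleExponent, Fin.sum_univ_succ]
    simp only [Fin.cons_zero, Fin.cons_succ]
    rw [← hsplit, ← hI, tupleExponent]

/-- Cut each monomial into two halves and symmetrize. Existence matters because `sInf ∅ = 0` in `ℝ`,
so without it no positive lower bound on `spNorm` would follow. -/
theorem exists_isMatrixRep {d : ℕ} (hd : Even d) {h : MvPolynomial (Fin n) ℝ}
    (hh : h.IsHomogeneous d) : ∃ M, IsMatrixRep d h M := by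
  classical
  rw [h.as_sum]
  refine Finset.sum_induction _ (fun g => ∃ M, IsMatrixRep d g M) ?_ ?_ ?_
  · rintro g₁ g₂ ⟨M₁, h₁⟩ ⟨M₂, h₂⟩
    refine ⟨M₁ + M₂, h₁.1.add h₂.1, fun x => ?_⟩
    rw [Matrix.add_mulVec, dotProduct_add, h₁.2, h₂.2, map_add]
  · exact ⟨0, Matrix.isSymm_zero, fun x => by simp⟩
  · intro α hα
    have hdeg : α.degree = d / 2 + d / 2 := by
      have h1 : α.degree = d := by
        rw [Finsupp.degree_eq_weight_one]
        exact hh (MvPolynomial.mem_support_iff.1 hα)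
      rw [h1]
      obtain ⟨k, rfl⟩ := hd
      omega
    obtain ⟨τ, hτ⟩ := exists_tupleExponent_eq _ α hdeg
    let I : Fin (d / 2) → Fin n := fun l => τ (Fin.castAdd _ l)
    let J : Fin (d / 2) → Fin n := fun l => τ (Fin.natAdd _ l)
    have hIJ : tupleExponent I + tupleExponent J = α := by
      rw [← hτ, tupleExponent, tupleExponent, tupleExponent, Fin.sum_univ_add]
    let c := h.coeff α / 2
    refine ⟨Matrix.single I J c + Matrix.single J I c, ?_, fun x => ?_⟩
    · rw [Matrix.IsSymm, Matrix.transpose_add, Matrix.transpose_single, Matrix.transpose_single,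
        add_comm]
    · rw [← hIJ, eval_monomial_tupleExponent, Matrix.add_mulVec, dotProduct_add,
        Matrix.single_mulVec, Matrix.single_mulVec]
      simp only [dotProduct, Function.update_apply, Pi.zero_apply, mul_ite, mul_zero,
        Finset.sum_ite_eq', Finset.mem_univ, if_true, hIJ, c]
      ring

theorem le_spNorm {d : ℕ} (hd : Even d) {h : MvPolynomial (Fin n) ℝ} (hh : h.IsHomogeneous d)
    {r : ℝ} (hr : ∀ M, IsMatrixRep d h M → r ≤ ‖Matrix.toEuclideanCLM (𝕜 := ℝ) M‖) :
    r ≤ spNorm d h := by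
  obtain ⟨M, hM⟩ := exists_isMatrixRep hd hh
  refine le_csInf ⟨_, M, hM, rfl⟩ ?_
  rintro _ ⟨M, hM, rfl⟩
  exact hr M hM

end matrixRep

/-! ### Powers of the clique polynomial -/

section cliquePower

variable {n : ℕ} {G : SimpleGraph (Fin n)}

open Classical in
theorem cliquePoly_isHomogeneous (G : SimpleGraph (Fin n)) : (cliquePoly G).IsHomogeneous 4 := by
  refine MvPolynomial.IsHomogeneous.sum _ _ _ fun s hs => ?_
  have h := MvPolynomial.IsHomogeneous.prod s (fun i => (MvPolynomial.X i : MvPolynomial (Fin n) ℝ))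
    (fun _ => 1) fun i _ => MvPolynomial.isHomogeneous_X _ _
  rwa [Finset.sum_const, smul_eq_mul, mul_one, (SimpleGraph.mem_cliqueFinset_iff.1 hs).2] at h

open Classical in
theorem eval_one_cliquePoly_pow (G : SimpleGraph (Fin n)) (m : ℕ) :
    MvPolynomial.eval (fun _ => 1) (cliquePoly G ^ m) = ((G.cliqueFinset 4).card : ℝ) ^ m := by
  rw [map_pow, eval_cliquePoly]
  simp

open Classical in
/-- Every monomial of a power of the clique polynomial is a product of clique monomials. -/
theorem exists_cliques_of_mem_support {m : ℕ} {α : Fin n →₀ ℕ}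
    (hα : α ∈ (cliquePoly G ^ m).support) :
    ∃ c : Fin m → Finset (Fin n), (∀ k, c k ∈ G.cliqueFinset 4) ∧
      ∀ v, α v = (Finset.univ.filter fun k => v ∈ c k).card := by
  have hexp : cliquePoly G ^ m = ∑ c ∈ Fintype.piFinset fun _ : Fin m => G.cliqueFinset 4,
      MvPolynomial.monomial (∑ k, ∑ i ∈ c k, Finsupp.single i 1) (1 : ℝ) := by
    have h1 : cliquePoly G ^ m = ∏ _k : Fin m, cliquePoly G := by simp
    rw [h1, cliquePoly, Finset.prod_univ_sum]
    refine Finset.sum_congr rfl fun c _ => ?_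
    rw [MvPolynomial.monomial_sum_one]
    refine Finset.prod_congr rfl fun k _ => ?_
    rw [MvPolynomial.monomial_sum_one]
    rfl
  rw [hexp] at hα
  obtain ⟨c, hc, hαc⟩ := Finset.mem_biUnion.1 (MvPolynomial.support_sum hα)
  refine ⟨c, Fintype.mem_piFinset.1 hc, fun v => ?_⟩
  rw [Finset.mem_singleton.1 (MvPolynomial.support_monomial_subset hαc)]
  simp [Finsupp.finsetSum_apply, Finsupp.single_apply]

-- All entries of `I` and `J` lie in the union of `m` cliques, which has at most `4m` vertices.
open Classical in
theorem card_filter_mem_support_le (G : SimpleGraph (Fin n)) (m κ : ℕ) :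
    (Finset.univ.filter (fun x : (Fin κ → Fin n) × (Fin κ → Fin n) =>
      tupleExponent x.1 + tupleExponent x.2 ∈ (cliquePoly G ^ m).support)).card ≤
      (G.cliqueFinset 4).card ^ m * (4 * m) ^ (κ + κ) := by
  let U : (Fin m → Finset (Fin n)) → Finset (Fin n) := fun c => Finset.univ.biUnion c
  let Z := Fintype.piFinset fun _ : Fin m => G.cliqueFinset 4
  have hsub : Finset.univ.filter (fun x : (Fin κ → Fin n) × (Fin κ → Fin n) =>
      tupleExponent x.1 + tupleExponent x.2 ∈ (cliquePoly G ^ m).support) ⊆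
      Z.biUnion fun c => (Fintype.piFinset fun _ => U c) ×ˢ (Fintype.piFinset fun _ => U c) := by
    rintro ⟨I, J⟩ hIJ
    obtain ⟨c, hc, hα⟩ := exists_cliques_of_mem_support (Finset.mem_filter.1 hIJ).2
    have hmem : ∀ v, 0 < (tupleExponent I + tupleExponent J) v → v ∈ U c := by
      intro v hv
      rw [hα v, Finset.card_pos] at hv
      obtain ⟨k, hk⟩ := hv
      exact Finset.mem_biUnion.2 ⟨k, Finset.mem_univ _, (Finset.mem_filter.1 hk).2⟩
    have hpos : ∀ (I : Fin κ → Fin n) l, 0 < tupleExponent I (I l) := by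
      intro I l
      rw [tupleExponent_apply, Finset.card_pos]
      exact ⟨l, by simp⟩
    refine Finset.mem_biUnion.2 ⟨c, Fintype.mem_piFinset.2 hc, Finset.mem_product.2
      ⟨Fintype.mem_piFinset.2 fun l => hmem _ ?_, Fintype.mem_piFinset.2 fun l => hmem _ ?_⟩⟩
    · exact Nat.add_pos_left (hpos I l) _
    · exact Nat.add_pos_right _ (hpos J l)
  refine (Finset.card_le_card hsub).trans ?_
  have hcard : Z.card = (G.cliqueFinset 4).card ^ m := by
    simp [Z, Fintype.card_piFinset]
  rw [← hcard]
  refine Finset.card_biUnion_le_card_mul _ _ _ fun c hc => ?_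
  have hU : (U c).card ≤ 4 * m := by
    have h := Finset.card_biUnion_le_card_mul Finset.univ c 4 fun k _ =>
      (SimpleGraph.mem_cliqueFinset_iff.1 (Fintype.mem_piFinset.1 hc k)).2.le
    rw [Finset.card_fin] at h
    linarith
  rw [Finset.card_product, Fintype.card_piFinset_const, ← pow_add]
  exact Nat.pow_le_pow_left hU _

open Classical in
/-- The cliques with at most four vertices. -/
noncomputable def smallCliques (G : SimpleGraph (Fin n)) : Finset (Finset (Fin n)) :=
  (Finset.range 5).biUnion fun j => G.cliqueFinset j

-- A vertex occurs in `I` at most as often as it is covered by the cliques `c k`. Its occurrences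
-- can therefore be assigned to distinct cliques, which splits `I` into subcliques `u k ⊆ c k` of
-- total size `κ`.
open Classical in
theorem exists_rows_bound (G : SimpleGraph (Fin n)) (m κ : ℕ) :
    ∃ R : Finset (Fin κ → Fin n),
      (∀ I J : Fin κ → Fin n,
        tupleExponent I + tupleExponent J ∈ (cliquePoly G ^ m).support → I ∈ R) ∧
      R.card ≤ ((Fintype.piFinset fun _ : Fin m => smallCliques G).filter
        fun u => ∑ k, (u k).card = κ).card * κ ^ κ := by
  let Z := (Fintype.piFinset fun _ : Fin m => smallCliques G).filter fun u => ∑ k, (u k).card = κ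
  refine ⟨Z.biUnion fun u => Fintype.piFinset fun _ => Finset.univ.biUnion u, ?_, ?_⟩
  · intro I J hIJ
    obtain ⟨c, hc, hα⟩ := exists_cliques_of_mem_support hIJ
    have hle : ∀ v, tupleExponent I v ≤ (Finset.univ.filter fun k => v ∈ c k).card := fun v => by
      rw [← hα v]
      exact Nat.le_add_right _ _
    -- `K v` is the set of indices of the cliques to which the occurrences of `v` in `I` are
    -- assigned.
    choose K hK hKc using fun v => Finset.exists_subset_card_eq (hle v)
    let u : Fin m → Finset (Fin n) := fun k => Finset.univ.filter fun v => k ∈ K v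
    have huc : ∀ k, u k ⊆ c k := fun k v hv =>
      (Finset.mem_filter.1 (hK v (Finset.mem_filter.1 hv).2)).2
    refine Finset.mem_biUnion.2 ⟨u, Finset.mem_filter.2 ⟨Fintype.mem_piFinset.2 fun k => ?_, ?_⟩,
      Fintype.mem_piFinset.2 fun l => ?_⟩
    · have h4 := SimpleGraph.mem_cliqueFinset_iff.1 (hc k)
      refine Finset.mem_biUnion.2 ⟨(u k).card, Finset.mem_range.2 ?_,
        SimpleGraph.mem_cliqueFinset_iff.2 ⟨h4.1.subset (by exact_mod_cast huc k), rfl⟩⟩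
      have := Finset.card_le_card (huc k)
      have := h4.2
      omega
    · calc ∑ k, (u k).card = ∑ v, (K v).card := by
            simp only [u, Finset.card_eq_sum_ones, Finset.sum_filter]
            rw [Finset.sum_comm]
            simp
        _ = ∑ v, tupleExponent I v := Finset.sum_congr rfl fun v _ => hKc v
        _ = κ := by
            simp only [tupleExponent_apply]
            rw [← Finset.card_eq_sum_card_fiberwise (fun _ _ => Finset.mem_coe.2 (Finset.mem_univ _)),
              Finset.card_fin]
    · have hpos : 0 < (K (I l)).card := by
        rw [hKc, tupleExponent_apply, Finset.card_pos]
        exact ⟨l, by simp⟩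
      obtain ⟨k, hk⟩ := Finset.card_pos.1 hpos
      exact Finset.mem_biUnion.2 ⟨k, Finset.mem_univ _, by simp [u, hk]⟩
  · refine Finset.card_biUnion_le_card_mul _ _ _ fun u hu => ?_
    rw [Fintype.card_piFinset_const]
    refine Nat.pow_le_pow_left ?_ _
    exact Finset.card_biUnion_le.trans (Finset.mem_filter.1 hu).2.le

/-- Bounding the number of tuples of given total size by a generating function. -/
theorem card_filter_sum_card_eq_le {V : Type*} [DecidableEq V] (𝒞 : Finset (Finset V)) (m κ : ℕ)
    {z : ℝ} (hz : 0 < z) :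
    (((Fintype.piFinset fun _ : Fin m => 𝒞).filter fun u => ∑ k, (u k).card = κ).card : ℝ) ≤
      z ^ κ * (∑ u ∈ 𝒞, (z ^ u.card)⁻¹) ^ m := by
  have h1 : (∑ u ∈ 𝒞, (z ^ u.card)⁻¹) ^ m =
      ∑ u ∈ Fintype.piFinset fun _ : Fin m => 𝒞, ∏ k, (z ^ (u k).card)⁻¹ := by
    rw [← Finset.prod_univ_sum (fun _ : Fin m => 𝒞) fun _ u => (z ^ u.card)⁻¹]
    simp
  rw [h1, Finset.mul_sum, Finset.card_eq_sum_ones, Nat.cast_sum, Finset.sum_filter]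
  refine Finset.sum_le_sum fun u _ => ?_
  rw [Finset.prod_inv_distrib, Finset.prod_pow_eq_pow_sum]
  split_ifs with h
  · rw [h, mul_inv_cancel₀ (by positivity)]
    simp
  · positivity

-- Deleting a vertex from a clique leaves a clique with that vertex as a common neighbour.
open Classical in
theorem card_cliqueFinset_succ_le (G : SimpleGraph (Fin n)) (j : ℕ) :
    (G.cliqueFinset (j + 1)).card ≤ ∑ s ∈ G.cliqueFinset j, (commonNbrs G s).card := by
  rw [← Finset.card_sigma]
  refine le_trans (Finset.card_le_card (t := ((G.cliqueFinset j).sigma fun s =>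
    commonNbrs G s).image fun y => insert y.2 y.1) ?_) Finset.card_image_le
  intro t ht
  obtain ⟨hcl, hcard⟩ := SimpleGraph.mem_cliqueFinset_iff.1 ht
  obtain ⟨v, hv⟩ : t.Nonempty := Finset.card_pos.1 (by omega)
  refine Finset.mem_image.2 ⟨⟨t.erase v, v⟩, Finset.mem_sigma.2 ⟨?_, ?_⟩, Finset.insert_erase hv⟩
  · refine SimpleGraph.mem_cliqueFinset_iff.2 ⟨hcl.subset ?_, ?_⟩
    · exact_mod_cast Finset.erase_subset v t
    · rw [Finset.card_erase_of_mem hv, hcard]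
      rfl
  · refine mem_commonNbrs.2 fun w hw => ?_
    exact hcl (Finset.mem_of_mem_erase hw) hv (Finset.ne_of_mem_erase hw)

open Classical in
theorem IsTypical.card_cliqueFinset_succ_le (hG : IsTypical G) {j : ℕ} (hj : j ≤ 3) :
    ((G.cliqueFinset (j + 1)).card : ℝ) ≤
      (G.cliqueFinset j).card * (13 * Real.log n * cubeRoot n ^ (3 - j)) := by
  have h : ((G.cliqueFinset (j + 1)).card : ℝ) ≤
      ∑ s ∈ G.cliqueFinset j, ((commonNbrs G s).card : ℝ) := by
    exact_mod_cast _root_.card_cliqueFinset_succ_le G j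
  refine h.trans ?_
  rw [← nsmul_eq_mul, ← Finset.sum_const]
  refine Finset.sum_le_sum fun s hs => ?_
  have hc := (SimpleGraph.mem_cliqueFinset_iff.1 hs).2
  have := hG.card_commonNbrs_le s (by omega)
  rwa [hc] at this

/-- Up to logarithms the terms of sizes 0,…,4 are `1, θ^{3/2}, θ^2, θ^{3/2}, 1`: edges dominate. -/
theorem IsTypical.sum_smallCliques_le (hG : IsTypical G) (hn : 3 ≤ n) :
    ∑ u ∈ smallCliques G, (√(n : ℝ) ^ u.card)⁻¹ ≤
      5 * ((13 * Real.log n) ^ 4 * cubeRoot n ^ 2) := by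
  classical
  have hL := one_le_log hn
  have hθ1 := one_le_cubeRoot (n := n) (by omega)
  have hz2 : √(n : ℝ) ^ 2 = cubeRoot n ^ 3 := by
    rw [cubeRoot_pow_three, Real.sq_sqrt (Nat.cast_nonneg n)]
  have h0 : ((G.cliqueFinset 0).card : ℝ) = 1 := by
    have : G.cliqueFinset 0 = {∅} := by
      ext s
      simp [SimpleGraph.mem_cliqueFinset_iff, SimpleGraph.isNClique_zero]
    rw [this]
    simp
  have h1 := hG.card_cliqueFinset_succ_le (j := 0) (by norm_num)
  have h2 := hG.card_cliqueFinset_succ_le (j := 1) (by norm_num)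
  have h3 := hG.card_cliqueFinset_succ_le (j := 2) (by norm_num)
  have h4 := hG.card_cliqueFinset_succ_le (j := 3) (by norm_num)
  norm_num at h1 h2 h3 h4
  generalize hzdef : √(n : ℝ) = z at *
  generalize cubeRoot n = θ at *
  have hz1 : 1 ≤ z := by
    rw [← hzdef]
    exact Real.one_le_sqrt.2 (by exact_mod_cast (by omega : 1 ≤ n))
  have hzθ : z ≤ θ ^ 2 := by
    have : z ^ 2 ≤ (θ ^ 2) ^ 2 := by
      rw [hz2]
      calc θ ^ 3 ≤ θ ^ 4 := pow_le_pow_right₀ hθ1 (by norm_num)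
        _ = (θ ^ 2) ^ 2 := by ring
    exact (pow_le_pow_iff_left₀ (by linarith) (by positivity) two_ne_zero).1 this
  generalize hD : 13 * Real.log n = D at *
  have hD1 : 1 ≤ D := by linarith
  have hDp : ∀ j ≤ 4, D ^ j ≤ D ^ 4 := fun j hj => pow_le_pow_right₀ hD1 hj
  have hz0 : 0 < z := by linarith
  have hθ0 : 0 < θ := by linarith
  have hD0 : 0 < D := by linarith
  rw [h0] at h1
  have k1 : ((G.cliqueFinset 1).card : ℝ) ≤ D ^ 1 * θ ^ 3 := by linarith
  have k2 : ((G.cliqueFinset 2).card : ℝ) ≤ D ^ 2 * θ ^ 5 :=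
    h2.trans ((mul_le_mul_of_nonneg_right k1 (by positivity)).trans (le_of_eq (by ring)))
  have k3 : ((G.cliqueFinset 3).card : ℝ) ≤ D ^ 3 * θ ^ 6 :=
    h3.trans ((mul_le_mul_of_nonneg_right k2 (by positivity)).trans (le_of_eq (by ring)))
  have k4 : ((G.cliqueFinset 4).card : ℝ) ≤ D ^ 4 * θ ^ 6 :=
    h4.trans ((mul_le_mul_of_nonneg_right k3 (by positivity)).trans (le_of_eq (by ring)))
  have hz4 : θ ^ 6 = z ^ 4 := by
    calc θ ^ 6 = (θ ^ 3) ^ 2 := by ring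
      _ = (z ^ 2) ^ 2 := by rw [hz2]
      _ = z ^ 4 := by ring
  have hθ2 : 1 ≤ θ ^ 2 := one_le_pow₀ hθ1
  have key : ∀ j ∈ Finset.range 5, ((G.cliqueFinset j).card : ℝ) ≤ D ^ 4 * θ ^ 2 * z ^ j := by
    intro j hj
    rw [Finset.mem_range] at hj
    interval_cases j
    · rw [h0]
      have := hDp 0 (by norm_num)
      nlinarith
    · refine k1.trans ?_
      calc D ^ 1 * θ ^ 3 = D ^ 1 * (z * z) := by rw [← hz2]; ring
        _ ≤ D ^ 4 * (θ ^ 2 * z) := by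
            gcongr
            norm_num
        _ = _ := by ring
    · refine k2.trans ?_
      calc D ^ 2 * θ ^ 5 ≤ D ^ 4 * θ ^ 5 := by
            gcongr
            norm_num
        _ = D ^ 4 * θ ^ 2 * z ^ 2 := by rw [hz2]; ring
    · refine k3.trans ?_
      rw [hz4]
      calc D ^ 3 * z ^ 4 = D ^ 3 * (z * z ^ 3) := by ring
        _ ≤ D ^ 4 * (θ ^ 2 * z ^ 3) := by
            gcongr
            norm_num
        _ = _ := by ring
    · refine k4.trans ?_
      rw [hz4]
      have : 0 ≤ D ^ 4 * z ^ 4 := by positivity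
      nlinarith
  calc ∑ u ∈ smallCliques G, (z ^ u.card)⁻¹
      = ∑ j ∈ Finset.range 5, ∑ u ∈ G.cliqueFinset j, (z ^ u.card)⁻¹ := by
        refine Finset.sum_biUnion fun i _ j _ hij => Finset.disjoint_left.2 fun u hi hj => hij ?_
        rw [← (SimpleGraph.mem_cliqueFinset_iff.1 hi).2, (SimpleGraph.mem_cliqueFinset_iff.1 hj).2]
    _ ≤ ∑ j ∈ Finset.range 5, D ^ 4 * θ ^ 2 := by
        refine Finset.sum_le_sum fun j hj => ?_
        rw [Finset.sum_congr rfl fun u hu => by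
          rw [(SimpleGraph.mem_cliqueFinset_iff.1 hu).2], Finset.sum_const, nsmul_eq_mul,
          ← div_eq_mul_inv, div_le_iff₀ (by positivity)]
        exact key j hj
    _ = 5 * (D ^ 4 * θ ^ 2) := by
        rw [Finset.sum_const, Finset.card_range, nsmul_eq_mul]
        norm_num

end cliquePower

/-! ### Bounds for the two norms of powers of the clique polynomial. -/

section norms

variable {n : ℕ} {G : SimpleGraph (Fin n)}

theorem IsTypical.cubeRoot_pow_le (hG : IsTypical G) (hn : 3 ≤ n) {m : ℕ} (hm : 0 < m)
    {M : Matrix (Fin (4 * m / 2) → Fin n) (Fin (4 * m / 2) → Fin n) ℝ}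
    (hM : IsMatrixRep (4 * m) (cliquePoly G ^ m) M) :
    cubeRoot n ^ m ≤
      ((4 * m * Real.log n) ^ 20) ^ m * ‖Matrix.toEuclideanCLM (𝕜 := ℝ) M‖ ^ 2 := by
  classical
  have hL := one_le_log hn
  have hθ1 := one_le_cubeRoot (n := n) (by omega)
  have hθ0 : 0 < cubeRoot n := by linarith
  obtain ⟨R, hR, hRc⟩ := exists_rows_bound G m (4 * m / 2)
  have hsq := hM.sq_eval_one_le R hR
  rw [eval_one_cliquePoly_pow] at hsq
  have hsq' := hsq.trans (mul_le_mul_of_nonneg_right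
    (Nat.cast_le.2 (card_filter_mem_support_le G m (4 * m / 2))) (by positivity))
  have hcount := (Nat.cast_le (α := ℝ)).2 hRc
  rw [Nat.cast_mul] at hcount
  replace hcount := hcount.trans (mul_le_mul_of_nonneg_right
    (card_filter_sum_card_eq_le (smallCliques G) m (4 * m / 2) (z := √(n : ℝ))
      (Real.sqrt_pos.2 (by exact_mod_cast (by omega : 0 < n)))) (by positivity))
  have hsmall := hG.sum_smallCliques_le hn
  have hN := hG.le_card_cliqueFinset
  have hκ : 4 * m / 2 = 2 * m := by omega
  clear hsq hRc hR
  generalize ‖Matrix.toEuclideanCLM (𝕜 := ℝ) M‖ = μ at *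
  generalize R.card = r at *
  rw [hκ] at hsq' hcount
  push_cast at hsq' hcount
  generalize ((G.cliqueFinset 4).card : ℝ) = N at *
  have hz : √(n : ℝ) ^ (2 * m) = (cubeRoot n ^ 3) ^ m := by
    rw [pow_mul, Real.sq_sqrt (Nat.cast_nonneg n), cubeRoot_pow_three]
  rw [hz] at hcount
  have hn2 : (n : ℝ) ^ 2 = cubeRoot n ^ 6 := by
    rw [← cubeRoot_pow_three]
    ring
  rw [hn2] at hN
  generalize cubeRoot n = θ at *
  have hN0 : 0 < N := lt_of_lt_of_le (by positivity) hN
  have hm1 : (1 : ℝ) ≤ m := by exact_mod_cast hm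
  have hRb : (r : ℝ) ≤ ((θ ^ 3) ^ m * (5 * ((13 * Real.log n) ^ 4 * θ ^ 2)) ^ m) *
      (4 * m) ^ (2 * m) := by
    refine hcount.trans ?_
    gcongr
    norm_num
  have hNm : N ^ m * N ^ m ≤ N ^ m * ((4 * m) ^ (2 * m + 2 * m) *
      (((θ ^ 3) ^ m * (5 * ((13 * Real.log n) ^ 4 * θ ^ 2)) ^ m) * (4 * m) ^ (2 * m) * μ ^ 2)) := by
    calc N ^ m * N ^ m = (N ^ m) ^ 2 := by ring
      _ ≤ _ := hsq'
      _ ≤ (N ^ m * (4 * m) ^ (2 * m + 2 * m)) * ((((θ ^ 3) ^ m *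
          (5 * ((13 * Real.log n) ^ 4 * θ ^ 2)) ^ m) * (4 * m) ^ (2 * m)) * μ ^ 2) := by gcongr
      _ = _ := by ring
  have hNm' := le_of_mul_le_mul_left hNm (by positivity)
  have hΛ : 4 ≤ 4 * m * Real.log n := by nlinarith
  -- Here `109674240 = 768 · 5 · 13^4 < 4^14`, and `4 ≤ 4 m log n` absorbs it into the power.
  have hconst : 109674240 * Real.log n ^ 4 * (4 * m : ℝ) ^ 6 ≤ (4 * m * Real.log n) ^ 20 := by
    calc 109674240 * Real.log n ^ 4 * (4 * m : ℝ) ^ 6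
        ≤ 4 ^ 14 * Real.log n ^ 6 * (4 * m : ℝ) ^ 6 := by
          gcongr
          · norm_num
          · norm_num
      _ = 4 ^ 14 * (4 * m * Real.log n) ^ 6 := by ring
      _ ≤ (4 * m * Real.log n) ^ 14 * (4 * m * Real.log n) ^ 6 := by gcongr
      _ = _ := by ring
  -- `N^m` is at least `θ^{6m}` up to constants, while the row count costs `θ^{5m}`; the surplus
  -- `θ^m` is the gain.
  have hfin : θ ^ m * (θ ^ 5) ^ m ≤
      (((4 * m * Real.log n) ^ 20) ^ m * μ ^ 2) * (θ ^ 5) ^ m := by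
    calc θ ^ m * (θ ^ 5) ^ m = (θ ^ 6) ^ m := by ring
      _ ≤ (768 * N) ^ m := by
          gcongr
          linarith
      _ = 768 ^ m * N ^ m := mul_pow _ _ _
      _ ≤ 768 ^ m * ((4 * m) ^ (2 * m + 2 * m) * (((θ ^ 3) ^ m *
          (5 * ((13 * Real.log n) ^ 4 * θ ^ 2)) ^ m) * (4 * m) ^ (2 * m) * μ ^ 2)) := by gcongr
      _ = ((109674240 * Real.log n ^ 4 * (4 * m : ℝ) ^ 6) ^ m * μ ^ 2) * (θ ^ 5) ^ m := by
          have e1 : (4 * m : ℝ) ^ (2 * m + 2 * m) = ((4 * m : ℝ) ^ 4) ^ m := by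
            rw [← pow_mul]
            congr 1
            ring
          have e2 : (4 * m : ℝ) ^ (2 * m) = ((4 * m : ℝ) ^ 2) ^ m := pow_mul _ _ _
          rw [e1, e2]
          have e3 : (109674240 * Real.log n ^ 4 * (4 * m : ℝ) ^ 6) ^ m * (θ ^ 5) ^ m =
              768 ^ m * (((4 * m : ℝ) ^ 4) ^ m * ((θ ^ 3) ^ m *
                (5 * ((13 * Real.log n) ^ 4 * θ ^ 2)) ^ m * ((4 * m : ℝ) ^ 2) ^ m)) := by
            simp only [← mul_pow]
            congr 1
            ring
          calc _ = 768 ^ m * (((4 * m : ℝ) ^ 4) ^ m * ((θ ^ 3) ^ m *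
                (5 * ((13 * Real.log n) ^ 4 * θ ^ 2)) ^ m * ((4 * m : ℝ) ^ 2) ^ m)) * μ ^ 2 := by
                ring
            _ = _ := by
                rw [← e3]
                ring
      _ ≤ _ := by gcongr
  exact le_of_mul_le_mul_right hfin (by positivity)

theorem IsTypical.le_spNorm (hG : IsTypical G) (hn : 3 ≤ n) {m : ℕ} (hm : 0 < m) :
    (n : ℝ) ^ ((m : ℝ) / 6) / ((4 * m * Real.log n) ^ 10) ^ m ≤
      spNorm (4 * m) (cliquePoly G ^ m) := by
  refine _root_.le_spNorm ⟨2 * m, by ring⟩ ((cliquePoly_isHomogeneous G).pow m) fun M hM => ?_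
  have hL := one_le_log hn
  have hm1 : (1 : ℝ) ≤ m := by exact_mod_cast hm
  have hΛ : 0 < 4 * m * Real.log n := by positivity
  rw [div_le_iff₀ (by positivity)]
  refine (pow_le_pow_iff_left₀ (by positivity) (by positivity) two_ne_zero).1 ?_
  have h1 : ((n : ℝ) ^ ((m : ℝ) / 6)) ^ 2 = cubeRoot n ^ m := by
    rw [cubeRoot, ← Real.rpow_natCast, ← Real.rpow_natCast, ← Real.rpow_mul (Nat.cast_nonneg n),
      ← Real.rpow_mul (Nat.cast_nonneg n)]
    congr 1
    push_cast
    ring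
  rw [h1]
  refine (hG.cubeRoot_pow_le hn hm hM).trans (le_of_eq ?_)
  generalize 4 * m * Real.log n = Λ
  ring

theorem sum_sq_eq_one_of_mem_sphere (x : Metric.sphere (0 : EuclideanSpace ℝ (Fin n)) 1) :
    ∑ i, (x : EuclideanSpace ℝ (Fin n)) i ^ 2 = 1 := by
  have h := EuclideanSpace.norm_sq_eq (x : EuclideanSpace ℝ (Fin n))
  rw [norm_eq_of_mem_sphere] at h
  simpa using h.symm

theorem IsTypical.sphereNorm_pow_le (hG : IsTypical G) (hn : 3 ≤ n) {Λ : ℝ} (h4 : 4 ≤ Λ)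
    (hΛ : Real.log n ≤ Λ) (m : ℕ) : sphereNorm (cliquePoly G ^ m) ≤ (Λ ^ 19) ^ m := by
  have hL := one_le_log hn
  refine Real.iSup_le (fun x => ?_) (by positivity)
  rw [map_pow, abs_pow]
  refine pow_le_pow_left₀ (abs_nonneg _) ?_ m
  refine (hG.abs_eval_cliquePoly_le hn _ (sum_sq_eq_one_of_mem_sphere x)).trans ?_
  calc 32752512 * Real.log n ^ 6 ≤ 4 ^ 13 * Λ ^ 6 := by
        gcongr
        norm_num
    _ ≤ Λ ^ 13 * Λ ^ 6 := by gcongr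
    _ = Λ ^ 19 := by ring

/-- Needed to divide by the norm. The constant unit vector gives a positive value since a 4-clique
exists; boundedness is checked because an unbounded real `⨆` is 0. -/
theorem IsTypical.sphereNorm_pow_pos (hG : IsTypical G) (hn : 3 ≤ n) (m : ℕ) :
    0 < sphereNorm (cliquePoly G ^ m) := by
  classical
  have hn0 : (0 : ℝ) < n := by exact_mod_cast (by omega : 0 < n)
  let y : EuclideanSpace ℝ (Fin n) := WithLp.toLp 2 fun _ => (√(n : ℝ))⁻¹
  have hy : y ∈ Metric.sphere (0 : EuclideanSpace ℝ (Fin n)) 1 := by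
    rw [mem_sphere_zero_iff_norm, EuclideanSpace.norm_eq, Real.sqrt_eq_one]
    simp only [y, Real.norm_eq_abs, sq_abs, inv_pow, Real.sq_sqrt hn0.le, Finset.sum_const,
      Finset.card_fin, nsmul_eq_mul]
    exact mul_inv_cancel₀ hn0.ne'
  have hbdd : BddAbove (Set.range fun x : Metric.sphere (0 : EuclideanSpace ℝ (Fin n)) 1 =>
      |MvPolynomial.eval (fun i => (x : EuclideanSpace ℝ (Fin n)) i) (cliquePoly G ^ m)|) := by
    refine ⟨(32752512 * Real.log n ^ 6) ^ m, ?_⟩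
    rintro _ ⟨x, rfl⟩
    simp only [map_pow, abs_pow]
    exact pow_le_pow_left₀ (abs_nonneg _)
      (hG.abs_eval_cliquePoly_le hn _ (sum_sq_eq_one_of_mem_sphere x)) m
  refine lt_of_lt_of_le ?_ (le_ciSup hbdd ⟨y, hy⟩)
  rw [abs_pos, map_pow, eval_cliquePoly]
  refine pow_ne_zero _ (ne_of_gt (Finset.sum_pos (fun s _ => ?_) ?_))
  · refine Finset.prod_pos fun i _ => ?_
    simp only [y]
    positivity
  · rw [← Finset.card_pos]
    have h := hG.le_card_cliqueFinset
    have h2 : (0 : ℝ) < (G.cliqueFinset 4).card := lt_of_lt_of_le (by positivity) h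
    exact_mod_cast h2

end norms

/-! ### The main theorem. -/

theorem mainTheorem4 :
    ∃ (C : ℕ) (K : ℝ), ∀ n : ℕ, 2 ≤ n →
      1 - K / (n : ℝ) ≤ (randomGraph n).real {G : SimpleGraph (Fin n) |
        ∀ q : ℕ, 0 < q → 4 ∣ q →
          (n : ℝ) ^ ((q : ℝ) / 24) / ((q : ℝ) * Real.log n) ^ (C * q) ≤
            spNorm q (cliquePoly G ^ (q / 4)) / sphereNorm (cliquePoly G ^ (q / 4)) ∧
          (n : ℝ) ^ ((1 : ℝ) / 6) / ((q : ℝ) * Real.log n) ^ C ≤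
            spNorm q (cliquePoly G ^ (q / 4)) ^ (4 / (q : ℝ)) / sphereNorm (cliquePoly G)} := by
  -- `29 = 10 + 19`, the exponents of `4 m log n` lost in the spectral and sphere norms. For `n < 6`
  -- the probability bound is negative.
  refine ⟨29, 9437200, fun n hn2 => ?_⟩
  rcases lt_or_ge n 6 with hlt | hn
  · refine le_trans ?_ measureReal_nonneg
    have h1 : (0 : ℝ) < n := by exact_mod_cast (by omega : 0 < n)
    have h2 : (n : ℝ) < 6 := by exact_mod_cast hlt
    rw [sub_nonpos, le_div_iff₀ h1]
    linarith
  refine (randomGraph_real_isTypical hn).trans (measureReal_mono ?_ (measure_ne_top _ _))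
  rintro G hG q hq ⟨m, rfl⟩
  have hG : IsTypical G := hG
  have hn3 : 3 ≤ n := by omega
  have hm : 0 < m := by omega
  have hm1 : (1 : ℝ) ≤ m := by exact_mod_cast hm
  have hL := one_le_log hn3
  have hsp := hG.le_spNorm hn3 hm
  have hΛ4 : 4 ≤ 4 * m * Real.log n := by nlinarith
  have hΛL : Real.log n ≤ 4 * m * Real.log n := by nlinarith
  have hup := hG.sphereNorm_pow_le hn3 hΛ4 hΛL
  have hpos := hG.sphereNorm_pow_pos hn3
  rw [Nat.mul_div_cancel_left m (by norm_num : 0 < 4)]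
  push_cast
  generalize 4 * m * Real.log n = Λ at *
  have hΛ0 : 0 < Λ := by linarith
  have hΛ1 : 1 ≤ Λ := by linarith
  have hnp : 0 ≤ (n : ℝ) ^ ((m : ℝ) / 6) := by positivity
  constructor
  · have e : (4 * m : ℝ) / 24 = (m : ℝ) / 6 := by ring
    rw [e]
    calc (n : ℝ) ^ ((m : ℝ) / 6) / Λ ^ (29 * (4 * m))
        ≤ (n : ℝ) ^ ((m : ℝ) / 6) / ((Λ ^ 10) ^ m * (Λ ^ 19) ^ m) := by
          gcongr
          rw [← pow_mul, ← pow_mul, ← pow_add]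
          exact pow_le_pow_right₀ hΛ1 (by omega)
      _ = (n : ℝ) ^ ((m : ℝ) / 6) / (Λ ^ 10) ^ m / (Λ ^ 19) ^ m := by rw [div_div]
      _ ≤ _ := div_le_div₀ (le_trans (by positivity) hsp) hsp (hpos m) (hup m)
  · have e : (4 : ℝ) / (4 * m) = (m : ℝ)⁻¹ := by
      field_simp
    rw [e]
    -- The spectral bound is an exact `m`-th power, so its root loses nothing, and only the sphere
    -- norm of `f` itself is needed.
    have hroot : (n : ℝ) ^ ((1 : ℝ) / 6) / Λ ^ 10 ≤
        spNorm (4 * m) (cliquePoly G ^ m) ^ ((m : ℝ)⁻¹) := by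
      have h1 : (n : ℝ) ^ ((1 : ℝ) / 6) / Λ ^ 10 =
          ((n : ℝ) ^ ((m : ℝ) / 6) / (Λ ^ 10) ^ m) ^ ((m : ℝ)⁻¹) := by
        have h2 : (n : ℝ) ^ ((m : ℝ) / 6) = ((n : ℝ) ^ ((1 : ℝ) / 6)) ^ m := by
          rw [← Real.rpow_natCast, ← Real.rpow_mul (Nat.cast_nonneg n)]
          congr 1
          ring
        rw [h2, ← div_pow, Real.pow_rpow_inv_natCast (by positivity) hm.ne']
      rw [h1]
      exact Real.rpow_le_rpow (by positivity) hsp (by positivity)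
    have hpos1 := hpos 1
    have hup1 := hup 1
    rw [pow_one] at hpos1 hup1
    rw [pow_one] at hup1
    calc (n : ℝ) ^ ((1 : ℝ) / 6) / Λ ^ 29 = (n : ℝ) ^ ((1 : ℝ) / 6) / Λ ^ 10 / Λ ^ 19 := by
          rw [div_div]
          ring
      _ ≤ _ := div_le_div₀ (le_trans (by positivity) hroot) hroot hpos1 hup1
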